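/- **Setting.** Manifolds are smooth, finite dimensional, without boundary, Hausdorff and second countable; functions, maps, vector fields and connections are smooth. Let $\rho:Q\to N$ be a fibred manifold (surjective submersion) and $\Gamma$ an Ehresmann connection in $\rho$ with horizontal distribution $\mathcal H$ ($TQ=\mathcal H\oplus\ker T\rho$), horizontal projector $h$, horizontal lift $v\mapsto v^{\mathcal H}$, and curvature $R(X,Y)=[hX,hY]-h[hX,Y]-h[X,hY]+h^2[X,Y]$. For a function $L$ on $TQ$ let $FL:TQ\to T^*Q$ be its fibre derivative, $S=\partial_{\dot q^A}\otimes dq^A$, $\Delta=\dot q^A\partial_{\dot q^A}$, $\alpha_L=S^*(dL)$, $\omega_L=-d\alpha_L$, $E_L=\Delta(L)-L$ (and likewise on $TN$). Let $\tau_Q:TQ\to Q$ and $\tau_N:TN\to N$ be the projections. Let $L:TQ\to\mathbb R$ be hyperregular ($FL$ is a global diffeomorphism) and $\Gamma$-invariant, that is, $L((v^{\mathcal H})_{q_1})=L((v^{\mathcal H})_{q_2})$ for $v\in T_yN$ and $\rho(q_1)=\rho(q_2)=y$. Assume the compatibility condition: for $w\in\mathcal H$, the only $Z\in T_w\mathcal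 H$ with $i_Z\omega_L\in S^*((T_w\mathcal H)^0)$ is $Z=0$. Let $X_{nh}$ be the nonholonomic dynamics, i.e. the vector field on $\mathcal H$ with $X_{nh}\in T\mathcal H$ and $i_{X_{nh}}\omega_L-dE_L\in S^*((T\mathcal H)^0)$. Define $L^*:TN\to\mathbb R$ and a semibasic 1-form $\alpha^*$ on $TN$ by $$L^*(u)=L(u^{\mathcal H}_q),\qquad \alpha^*(u)(U)=-\big\langle FL(u^{\mathcal H}_q),\,R\big(u^{\mathcal H}_q,(T\tau_N(U))^{\mathcal H}_q\big)\big\rangle ,\qquad u\in T_yN,\ U\in T_u(TN),\ \rho(q)=y.$$ Assume that $\alpha^*$ is well defined, i.e. that the right-hand side does not depend on the choice of $q\in\rho^{-1}(y)$ (for $L^*$ this is the $\Gamma$-invariance). Let $Y^*$ be the vector field on $TN$ with $i_{Y^*}\omega_{L^*}=dE_{L^*}+\alpha^*$. *Solutions.* A vector field $X$ on $Q$ is a solution of the nonholonomic Hamilton–Jacobi problem given by $(L,\Gamma)$ if $X(Q)\subset\mathcal H$; $d(FL\circ X)\in\mathcal I(\mathcal H^0)$, the algebraic ideal of forms generated by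 the annihilator $\mathcal H^0$ of $\mathcal H$; and for every curve $\sigma$ in $Q$ defined on an open interval with $\dot\sigma(t)=T\tau_Q(X_{nh}(X(\sigma(t))))$ for all $t$, the curve $X\circ\sigma$ is an integral curve of $X_{nh}$. A vector field $Y$ on $N$ is a solution of the Hamilton–Jacobi problem given by $(L^*,\alpha^*)$ if $d(FL^*\circ Y)=0$ and for every curve $\mu$ in $N$ defined on an open interval with $\dot\mu(t)=T\tau_N(Y^*(Y(\mu(t))))$ for all $t$, the curve $Y\circ\mu$ is an integral curve of $Y^*$. **Theorem.** (i) Let $X$ be a solution of the nonholonomic Hamilton–Jacobi problem given by $(L,\Gamma)$. If $X$ is $\rho$-projectable to a vector field $Y$ on $N$ and $d(FL^*\circ Y)=0$, then $Y$ is a solution of the Hamilton–Jacobi problem given by $(L^*,\alpha^*)$. (ii) Conversely, let $Y$ be a solution of the Hamilton–Jacobi problem given by $(L^*,\alpha^*)$. If $d(FL\circ Y^{\mathcal H})\in\mathcal I(\mathcal H^0)$, then the horizontal lift $Y^{\mathcal H}$ is a solution of the nonholonomic Hamilton–Jacobi problem given by $(L,\Gamma)$. -/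

import Mathlib

open Set Function
open scoped Manifold ContDiff

/-! ### Differential forms of low degree on a manifold without boundary -/

section Forms

variable {E : Type*} [NormedAddCommGroup E] [NormedSpace ℝ E]
  {H : Type*} [TopologicalSpace H] (I : ModelWithCorners ℝ E H)
  {P : Type*} [TopologicalSpace P] [ChartedSpace H P]

/-- The expression of a 1-form `θ` in the preferred chart at `p`. -/
noncomputable def formInChart (θ : (p : P) → TangentSpace I p →L[ℝ] ℝ) (p : P) :
    E → (E →L[ℝ] ℝ) := fun y =>
  (θ ((extChartAt I p).symm y)).comp (mfderiv 𝓘(ℝ, E) I (extChartAt I p).symm y)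

/-- The exterior derivative `dθ` of a 1-form, as a function of a point and two tangent vectors:
in the chart at `p`, `dθ(u, w) = (D_u θ)(w) - (D_w θ)(u)`. -/
noncomputable def formDeriv (θ : (p : P) → TangentSpace I p →L[ℝ] ℝ) (p : P)
    (u w : TangentSpace I p) : ℝ :=
  let A : E →L[ℝ] (E →L[ℝ] ℝ) := fderiv ℝ (formInChart I θ p) (extChartAt I p p)
  let u' : E := mfderiv I 𝓘(ℝ, E) (extChartAt I p) p u
  let w' : E := mfderiv I 𝓘(ℝ, E) (extChartAt I p) p w
  A u' w' - A w' u'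

/-- `dθ = 0`. -/
def IsClosedForm (θ : (p : P) → TangentSpace I p →L[ℝ] ℝ) : Prop :=
  ∀ (p : P) (u w : TangentSpace I p), formDeriv I θ p u w = 0

/-- The 2-form `ν` belongs to the algebraic ideal generated by the annihilator `D⁰` of the
distribution `D`: at each point `ν = ∑ᵢ βᵢ ∧ μᵢ` with `μᵢ ∈ D⁰`. -/
def InIdealOfAnnihilator (D : (p : P) → Submodule ℝ (TangentSpace I p))
    (ν : (p : P) → TangentSpace I p → TangentSpace I p → ℝ) : Prop :=
  ∀ p : P, ∃ (m : ℕ) (β μ : Fin m → (TangentSpace I p →L[ℝ] ℝ)),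
    (∀ i, ∀ v ∈ D p, μ i v = 0) ∧
    ∀ u w : TangentSpace I p, ν p u w = ∑ i, (β i u * μ i w - β i w * μ i u)

end Forms

/-! ### Lagrangian mechanics on the tangent bundle -/

section Lagrangian

variable {E : Type*} [NormedAddCommGroup E] [NormedSpace ℝ E]
  {Q : Type*} [TopologicalSpace Q] [ChartedSpace E Q] [IsManifold 𝓘(ℝ, E) ∞ Q]

/-- The derivative `Tτ_Q : T_w(TQ) → T_{τ(w)}Q` of the projection `τ_Q : TQ → Q`. -/
noncomputable def tauDeriv (w : TangentBundle 𝓘(ℝ, E) Q) :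
    TangentSpace 𝓘(ℝ, E).tangent w →L[ℝ] TangentSpace 𝓘(ℝ, E) w.1 :=
  mfderiv 𝓘(ℝ, E).tangent 𝓘(ℝ, E) (fun z : TangentBundle 𝓘(ℝ, E) Q => z.1) w

/-- The vertical lift `T_{τ(w)}Q → T_w(TQ)`: the derivative at `w` of the inclusion of the
fibre through `w` into `TQ`. -/
noncomputable def vertLift (w : TangentBundle 𝓘(ℝ, E) Q) :
    TangentSpace 𝓘(ℝ, E) w.1 →L[ℝ] TangentSpace 𝓘(ℝ, E).tangent w :=
  mfderiv 𝓘(ℝ, E) 𝓘(ℝ, E).tangent (fun v : E => (⟨w.1, v⟩ : TangentBundle 𝓘(ℝ, E) Q)) w.2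

/-- The vertical endomorphism `S` of `T(TQ)`, `S = ∂/∂q̇ ⊗ dq`. -/
noncomputable def vertEndo (w : TangentBundle 𝓘(ℝ, E) Q) :
    TangentSpace 𝓘(ℝ, E).tangent w →L[ℝ] TangentSpace 𝓘(ℝ, E).tangent w :=
  (vertLift w).comp (tauDeriv w)

/-- The Liouville vector field `Δ = q̇ ∂/∂q̇`. -/
noncomputable def liouville (w : TangentBundle 𝓘(ℝ, E) Q) : TangentSpace 𝓘(ℝ, E).tangent w :=
  vertLift w w.2

/-- The differential of a function on `TQ`. -/
noncomputable def tdiff (f : TangentBundle 𝓘(ℝ, E) Q → ℝ) (w : TangentBundle 𝓘(ℝ, E) Q) :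
    TangentSpace 𝓘(ℝ, E).tangent w →L[ℝ] ℝ :=
  mfderiv 𝓘(ℝ, E).tangent 𝓘(ℝ, ℝ) f w

/-- The Legendre transformation `FL : TQ → T*Q`, i.e. the fibre derivative of `L`. -/
noncomputable def legendre (L : TangentBundle 𝓘(ℝ, E) Q → ℝ) (w : TangentBundle 𝓘(ℝ, E) Q) :
    TangentSpace 𝓘(ℝ, E) w.1 →L[ℝ] ℝ :=
  (fderiv ℝ (fun v : E => L (⟨w.1, v⟩ : TangentBundle 𝓘(ℝ, E) Q)) w.2 : E →L[ℝ] ℝ)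

/-- The energy `E_L = Δ(L) - L`. -/
noncomputable def energy (L : TangentBundle 𝓘(ℝ, E) Q → ℝ) (w : TangentBundle 𝓘(ℝ, E) Q) : ℝ :=
  tdiff L w (liouville w) - L w

/-- The Poincaré–Cartan 1-form `α_L = S^*(dL)`. -/
noncomputable def cartanOneForm (L : TangentBundle 𝓘(ℝ, E) Q → ℝ)
    (w : TangentBundle 𝓘(ℝ, E) Q) : TangentSpace 𝓘(ℝ, E).tangent w →L[ℝ] ℝ :=
  (tdiff L w).comp (vertEndo w)

/-- The Poincaré–Cartan 2-form `ω_L = -dα_L`. -/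
noncomputable def cartanTwoForm (L : TangentBundle 𝓘(ℝ, E) Q → ℝ)
    (w : TangentBundle 𝓘(ℝ, E) Q) (Z U : TangentSpace 𝓘(ℝ, E).tangent w) : ℝ :=
  -formDeriv 𝓘(ℝ, E).tangent (cartanOneForm L) w Z U

/-- `L` is hyperregular, i.e. `FL : TQ → T*Q` is a global diffeomorphism. Since `FL` is a smooth
map of fibre bundles over the identity of `Q`, this means that it is bijective on each fibre and
a local diffeomorphism, the latter being equivalent to `ω_L` being symplectic. -/
structure IsHyperregular (L : TangentBundle 𝓘(ℝ, E) Q → ℝ) : Prop where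
  bijective : ∀ q : Q, Bijective (α := TangentSpace 𝓘(ℝ, E) q)
    (β := TangentSpace 𝓘(ℝ, E) q →L[ℝ] ℝ) (fun v => legendre L ⟨q, v⟩)
  nondegenerate : ∀ (w : TangentBundle 𝓘(ℝ, E) Q) (Z : TangentSpace 𝓘(ℝ, E).tangent w),
    (∀ U, cartanTwoForm L w Z U = 0) → Z = 0

/-- A smooth vector field on `Q`. -/
def IsSmoothField (X : (q : Q) → TangentSpace 𝓘(ℝ, E) q) : Prop :=
  ContMDiff 𝓘(ℝ, E) 𝓘(ℝ, E).tangent ∞ (fun q => (⟨q, X q⟩ : TangentBundle 𝓘(ℝ, E) Q))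

/-- The 1-form `FL ∘ X` on `Q`. -/
noncomputable def legendreField (L : TangentBundle 𝓘(ℝ, E) Q → ℝ)
    (X : (q : Q) → TangentSpace 𝓘(ℝ, E) q) (q : Q) : TangentSpace 𝓘(ℝ, E) q →L[ℝ] ℝ :=
  legendre L ⟨q, X q⟩

/-- The Hamilton–Jacobi property of a vector field `X` on `Q` with respect to a vector field `ξ`
on `TQ` (only its values on the image of `X` matter): for each curve `σ` on an open interval with
`σ̇ = Tτ_Q(ξ(X(σ)))`, the curve `X ∘ σ` is an integral curve of `ξ`. -/
def HJCurveCondition (ξ : (w : TangentBundle 𝓘(ℝ, E) Q) → TangentSpace 𝓘(ℝ, E).tangent w)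
    (X : (q : Q) → TangentSpace 𝓘(ℝ, E) q) : Prop :=
  ∀ (s : Set ℝ), IsOpen s → s.OrdConnected → ∀ σ : ℝ → Q,
    IsMIntegralCurveOn (I := 𝓘(ℝ, E)) σ (fun q => tauDeriv ⟨q, X q⟩ (ξ ⟨q, X q⟩)) s →
    IsMIntegralCurveOn (I := 𝓘(ℝ, E).tangent)
      (fun t => (⟨σ t, X (σ t)⟩ : TangentBundle 𝓘(ℝ, E) Q)) ξ s

/-! ### Systems with an external force -/

/-- The dynamics `ξ_{L,α}` of the Lagrangian `L` with external force `α` (a semibasic 1-form on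
`TQ`): the solution of `i_ξ ω_L = dE_L + α`. It is unique when `L` is regular. -/
noncomputable def forcedDynamics (L : TangentBundle 𝓘(ℝ, E) Q → ℝ)
    (α : (w : TangentBundle 𝓘(ℝ, E) Q) → TangentSpace 𝓘(ℝ, E).tangent w → ℝ)
    (w : TangentBundle 𝓘(ℝ, E) Q) : TangentSpace 𝓘(ℝ, E).tangent w :=
  Classical.epsilon fun Z => ∀ U, cartanTwoForm L w Z U = tdiff (energy L) w U + α w U

/-- `X` is a solution for the Hamilton–Jacobi problem given by `L` and the force `α`. -/
structure IsForcedHJSolution (L : TangentBundle 𝓘(ℝ, E) Q → ℝ)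
    (α : (w : TangentBundle 𝓘(ℝ, E) Q) → TangentSpace 𝓘(ℝ, E).tangent w → ℝ)
    (X : (q : Q) → TangentSpace 𝓘(ℝ, E) q) : Prop where
  smooth : IsSmoothField X
  closed : IsClosedForm 𝓘(ℝ, E) (legendreField L X)
  curves : HJCurveCondition (forcedDynamics L α) X

/-! ### Nonholonomic systems with constraints given by the image of a projector `h` of `TQ` -/

/-- The map `TQ → TQ` given by a field `h` of endomorphisms. -/
noncomputable def projMap (h : (q : Q) → TangentSpace 𝓘(ℝ, E) q →L[ℝ] TangentSpace 𝓘(ℝ, E) q)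
    (w : TangentBundle 𝓘(ℝ, E) Q) : TangentBundle 𝓘(ℝ, E) Q :=
  ⟨w.1, h w.1 w.2⟩

/-- The constraint submanifold `M = im h` of `TQ`. -/
def constraintSet (h : (q : Q) → TangentSpace 𝓘(ℝ, E) q →L[ℝ] TangentSpace 𝓘(ℝ, E) q) :
    Set (TangentBundle 𝓘(ℝ, E) Q) :=
  {w | w.2 ∈ LinearMap.range (h w.1).toLinearMap}

/-- The tangent space `T_wM` at `w ∈ M`. Since `h` is a smooth field of projectors, `M` is the image
of the smooth retraction `projMap h`, so `T_wM` is the range of the derivative of the latter. -/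
noncomputable def constraintTangent
    (h : (q : Q) → TangentSpace 𝓘(ℝ, E) q →L[ℝ] TangentSpace 𝓘(ℝ, E) q)
    (w : TangentBundle 𝓘(ℝ, E) Q) : Set (TangentSpace 𝓘(ℝ, E).tangent w) :=
  {Z | ∃ Z' : TangentSpace 𝓘(ℝ, E).tangent w,
    Z = mfderiv 𝓘(ℝ, E).tangent 𝓘(ℝ, E).tangent (projMap h) w Z'}

/-- The covectors `S^*((TM)⁰)` at `w ∈ M`. -/
noncomputable def reactionForces
    (h : (q : Q) → TangentSpace 𝓘(ℝ, E) q →L[ℝ] TangentSpace 𝓘(ℝ, E) q)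
    (w : TangentBundle 𝓘(ℝ, E) Q) : Set (TangentSpace 𝓘(ℝ, E).tangent w →L[ℝ] ℝ) :=
  {F | ∃ β : TangentSpace 𝓘(ℝ, E).tangent w →L[ℝ] ℝ,
    (∀ Z ∈ constraintTangent h w, β Z = 0) ∧ F = β.comp (vertEndo w)}

/-- The compatibility condition `F^⊥ ∩ TM = 0` along `M`, where `F⁰ = S^*((TM)⁰)` and `⊥` is the
orthogonal for `ω_L`. -/
def IsCompatible (L : TangentBundle 𝓘(ℝ, E) Q → ℝ)
    (h : (q : Q) → TangentSpace 𝓘(ℝ, E) q →L[ℝ] TangentSpace 𝓘(ℝ, E) q) : Prop :=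
  ∀ w ∈ constraintSet h, ∀ Z ∈ constraintTangent h w,
    (∃ F ∈ reactionForces h w, ∀ U, cartanTwoForm L w Z U = F U) → Z = 0

/-- The nonholonomic dynamics `X_nh` along `M`: the solution of `i_X ω_L - dE_L ∈ S^*((TM)⁰)`,
`X ∈ TM`. It is unique under the compatibility condition. Its values off `M` are irrelevant. -/
noncomputable def nonholonomicDynamics (L : TangentBundle 𝓘(ℝ, E) Q → ℝ)
    (h : (q : Q) → TangentSpace 𝓘(ℝ, E) q →L[ℝ] TangentSpace 𝓘(ℝ, E) q)
    (w : TangentBundle 𝓘(ℝ, E) Q) : TangentSpace 𝓘(ℝ, E).tangent w :=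
  Classical.epsilon fun Z => Z ∈ constraintTangent h w ∧
    ∃ F ∈ reactionForces h w, ∀ U, cartanTwoForm L w Z U - tdiff (energy L) w U = F U

/-- `X` is a solution for the nonholonomic Hamilton–Jacobi problem given by `L` and `M = im h`. -/
structure IsNonholonomicHJSolution (L : TangentBundle 𝓘(ℝ, E) Q → ℝ)
    (h : (q : Q) → TangentSpace 𝓘(ℝ, E) q →L[ℝ] TangentSpace 𝓘(ℝ, E) q)
    (X : (q : Q) → TangentSpace 𝓘(ℝ, E) q) : Prop where
  smooth : IsSmoothField X
  mem : ∀ q, (⟨q, X q⟩ : TangentBundle 𝓘(ℝ, E) Q) ∈ constraintSet h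
  ideal : InIdealOfAnnihilator 𝓘(ℝ, E) (fun q => LinearMap.range (h q).toLinearMap)
    (formDeriv 𝓘(ℝ, E) (legendreField L X))
  curves : HJCurveCondition (nonholonomicDynamics L h) X

end Lagrangian

/-! ### Čaplygin systems -/

section Caplygin

variable {E : Type*} [NormedAddCommGroup E] [NormedSpace ℝ E]
  {E' : Type*} [NormedAddCommGroup E'] [NormedSpace ℝ E']
  {Q : Type*} [TopologicalSpace Q] [ChartedSpace E Q] [IsManifold 𝓘(ℝ, E) ∞ Q]
  {N : Type*} [TopologicalSpace N] [ChartedSpace E' N] [IsManifold 𝓘(ℝ, E') ∞ N]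

/-- `ρ : Q → N` is a fibred manifold: a smooth surjective submersion. -/
structure IsFibredManifold (ρ : Q → N) : Prop where
  smooth : ContMDiff 𝓘(ℝ, E) 𝓘(ℝ, E') ∞ ρ
  surjective : Surjective ρ
  submersion : ∀ q, Surjective (mfderiv 𝓘(ℝ, E) 𝓘(ℝ, E') ρ q)

variable (E E') in
/-- An Ehresmann connection in `ρ : Q → N`, given by its horizontal lift: a smooth splitting
`T_{ρ(q)}N → T_qQ` of `Tρ`. The horizontal space at `q` is the range of the lift; it is a
complement of the vertical space `ker T_qρ`. -/
structure EhresmannConnection (ρ : Q → N) where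
  /-- the horizontal lift `y ↦ y^ℋ` at `q` -/
  lift : (q : Q) → TangentSpace 𝓘(ℝ, E') (ρ q) →L[ℝ] TangentSpace 𝓘(ℝ, E) q
  mfderiv_lift : ∀ (q : Q) (v : TangentSpace 𝓘(ℝ, E') (ρ q)),
    mfderiv 𝓘(ℝ, E) 𝓘(ℝ, E') ρ q (lift q v) = v
  smooth : ∀ q₀ : Q, ContMDiffAt 𝓘(ℝ, E) 𝓘(ℝ, E' →L[ℝ] E) ∞
    (inTangentCoordinates 𝓘(ℝ, E') 𝓘(ℝ, E) ρ id lift q₀) q₀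

namespace EhresmannConnection

variable {ρ : Q → N} (Γ : EhresmannConnection E E' ρ)

/-- The horizontal projector `h : TQ → ℋ`. -/
noncomputable def hor (q : Q) : TangentSpace 𝓘(ℝ, E) q →L[ℝ] TangentSpace 𝓘(ℝ, E) q :=
  (Γ.lift q).comp (mfderiv 𝓘(ℝ, E) 𝓘(ℝ, E') ρ q)

/-- The vector field `hX`. -/
noncomputable def horField (X : (q : Q) → TangentSpace 𝓘(ℝ, E) q) :
    (q : Q) → TangentSpace 𝓘(ℝ, E) q := fun q => Γ.hor q (X q)

/-- The horizontal lift `Y^ℋ` of a vector field `Y` on `N`. -/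
noncomputable def liftField (Y : (y : N) → TangentSpace 𝓘(ℝ, E') y) : (q : Q) → TangentSpace 𝓘(ℝ, E) q :=
  fun q => Γ.lift q (Y (ρ q))

/-- The curvature `R = ½[h, h]` on vector fields:
`R(X, Y) = [hX, hY] - h[hX, Y] - h[X, hY] + h²[X, Y]`. -/
noncomputable def curvatureField (X Y : (q : Q) → TangentSpace 𝓘(ℝ, E) q) (q : Q) :
    TangentSpace 𝓘(ℝ, E) q :=
  VectorField.mlieBracket 𝓘(ℝ, E) (Γ.horField X) (Γ.horField Y) q
    - Γ.hor q (VectorField.mlieBracket 𝓘(ℝ, E) (Γ.horField X) Y q)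
    - Γ.hor q (VectorField.mlieBracket 𝓘(ℝ, E) X (Γ.horField Y) q)
    + Γ.hor q (Γ.hor q (VectorField.mlieBracket 𝓘(ℝ, E) X Y q))

/-- The value of the curvature tensor on tangent vectors at `q`, computed with local smooth
extensions of these vectors (on which it does not depend, `R` being a tensor). -/
noncomputable def curvature (q : Q) (u v : TangentSpace 𝓘(ℝ, E) q) : TangentSpace 𝓘(ℝ, E) q :=
  Γ.curvatureField (FiberBundle.extend E u) (FiberBundle.extend E v) q

/-- The lagrangian `L` is `Γ`-invariant: `L((Y^ℋ)_{q₁}) = L((Y^ℋ)_{q₂})`. -/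
def IsInvariant (L : TangentBundle 𝓘(ℝ, E) Q → ℝ) : Prop :=
  ∀ w₁ ∈ constraintSet Γ.hor, ∀ w₂ ∈ constraintSet Γ.hor,
    tangentMap 𝓘(ℝ, E) 𝓘(ℝ, E') ρ w₁ = tangentMap 𝓘(ℝ, E) 𝓘(ℝ, E') ρ w₂ → L w₁ = L w₂

/-- The formula `U ↦ -α_L(x)(Ũ)` defining `α^*` does not depend on the point of the fibre used:
for `x = u^ℋ` at `q` and `Tτ_Q(Ũ) = R(u^ℋ, v^ℋ)` one has `α_L(x)(Ũ) = FL(x)(R(u^ℋ, v^ℋ))`, and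
this number depends on `u, v ∈ T_yN` only, not on the point `q` over `y`. -/
def ForceWellDefined (L : TangentBundle 𝓘(ℝ, E) Q → ℝ) : Prop :=
  ∀ q₁ q₂ : Q, ∀ (u₁ v₁ : TangentSpace 𝓘(ℝ, E') (ρ q₁)) (u₂ v₂ : TangentSpace 𝓘(ℝ, E') (ρ q₂)),
    (⟨ρ q₁, u₁⟩ : TangentBundle 𝓘(ℝ, E') N) = ⟨ρ q₂, u₂⟩ →
    (⟨ρ q₁, v₁⟩ : TangentBundle 𝓘(ℝ, E') N) = ⟨ρ q₂, v₂⟩ →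
    legendre L ⟨q₁, Γ.lift q₁ u₁⟩ (Γ.curvature q₁ (Γ.lift q₁ u₁) (Γ.lift q₁ v₁)) =
      legendre L ⟨q₂, Γ.lift q₂ u₂⟩ (Γ.curvature q₂ (Γ.lift q₂ u₂) (Γ.lift q₂ v₂))

/-- A point of the fibre of `ρ` over the base point of `u ∈ TN`. -/
noncomputable def base (hρ : Surjective ρ) (u : TangentBundle 𝓘(ℝ, E') N) : Q := surjInv hρ u.1

/-- The horizontal lift, at `base hρ u`, of a vector `v` tangent to `N` at the base point of `u`
(the rewriting only transports `v` along `ρ (base hρ u) = u.1`). -/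
noncomputable def liftAt (hρ : Surjective ρ) (u : TangentBundle 𝓘(ℝ, E') N)
    (v : TangentSpace 𝓘(ℝ, E') u.1) : TangentSpace 𝓘(ℝ, E) (base hρ u) :=
  Γ.lift (base hρ u) ((surjInv_eq hρ u.1).symm ▸ v)

/-- The reduced lagrangian `L^*(u) = L(u^ℋ)` on `TN`; by invariance the point over `τ_N(u)` at
which `u` is lifted is irrelevant. -/
noncomputable def reducedLagrangian (hρ : Surjective ρ) (L : TangentBundle 𝓘(ℝ, E) Q → ℝ)
    (u : TangentBundle 𝓘(ℝ, E') N) : ℝ :=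
  L ⟨base hρ u, Γ.liftAt hρ u u.2⟩

/-- The reduced force `α^*(u)(U) = -FL(u^ℋ)(R(u^ℋ, (Tτ_N(U))^ℋ))` on `TN`. -/
noncomputable def reducedForce (hρ : Surjective ρ) (L : TangentBundle 𝓘(ℝ, E) Q → ℝ)
    (u : TangentBundle 𝓘(ℝ, E') N) (U : TangentSpace 𝓘(ℝ, E').tangent u) : ℝ :=
  -legendre L ⟨base hρ u, Γ.liftAt hρ u u.2⟩
    (Γ.curvature (base hρ u) (Γ.liftAt hρ u u.2) (Γ.liftAt hρ u (tauDeriv u U)))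

end EhresmannConnection

end Caplygin

open Filter Topology Bundle

/-! Both Hamilton–Jacobi conditions on curves are statements about second-order vector fields. For
such a field `ξ` along the image of `X`, the projected field is `X` itself, so the condition says
exactly that `TX ∘ X = ξ ∘ X` (`hjCurveCondition_iff`). A horizontal `X` that projects to `Y` is
`Y^ℋ`, so both parts of the theorem follow from one pointwise equivalence,
`hjCurveCondition_liftField_iff`: `T(Y^ℋ) ∘ Y^ℋ` equals the nonholonomic dynamics along `Y^ℋ`
exactly when `TY ∘ Y` equals the reduced dynamics along `Y`. The ideal and closedness conditions
play no role in this equivalence; they pass from hypothesis to conclusion unchanged.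

In charts centred at `q` and `ρ q`, write `r` for `ρ` and `ℓ(x)` for the horizontal lift, with `ℓ`
and `Dℓ` evaluated at the centre unless an argument is shown. If the reduced dynamics at `v` is `(v,
η)`, then the nonholonomic dynamics at `ℓ v` is `(ℓ v, Dℓ(ℓ v) v + ℓ η)` (`exists_dynamics_eq`). The
product rule gives the tangent map of `Y^ℋ` along `Y^ℋ` the same shape, with `DY(Y)` in place of
`η`. Since `ℓ` is injective, the two equations agree.

The formula for the dynamics comes from differentiating `L^*(r(x), c) = L(x, ℓ(x) c)`
(`localRep_reducedLagrangian`). Comparing the Euler–Lagrange expressions of `L^*` and `L` on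
horizontal vectors leaves the terms `FL(Dℓ(ℓ v) c - Dℓ(ℓ c) v)`. By `curvature_liftModel` the
argument of `FL` is the curvature `R(ℓ v, ℓ c)`, so these terms are absorbed by the force `α^*`. The
vertical Hessian of `L^*` is that of `L` restricted to `ℋ`, and compatibility makes it
nondegenerate; hence the reduced dynamics exists and is unique. -/

/-- The chain rule, read in the model spaces. -/
lemma HasMFDerivAt.comp_apply_eq {F F' F'' : Type*} [NormedAddCommGroup F] [NormedSpace ℝ F]
    [NormedAddCommGroup F'] [NormedSpace ℝ F'] [NormedAddCommGroup F''] [NormedSpace ℝ F'']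
    {H H' H'' : Type*} [TopologicalSpace H] [TopologicalSpace H'] [TopologicalSpace H'']
    {I : ModelWithCorners ℝ F H} {I' : ModelWithCorners ℝ F' H'} {I'' : ModelWithCorners ℝ F'' H''}
    {M M' M'' : Type*} [TopologicalSpace M] [ChartedSpace H M] [TopologicalSpace M']
    [ChartedSpace H' M'] [TopologicalSpace M''] [ChartedSpace H'' M'']
    {f : M → M'} {g : M' → M''} {k : M → M''} {x : M} {y : M'}
    {f' : F →L[ℝ] F'} {g' : F' →L[ℝ] F''} {k' : F →L[ℝ] F''}
    (hg : HasMFDerivAt I' I'' g y g') (hf : HasMFDerivAt I I' f x f') (hy : f x = y)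
    (hk : HasMFDerivAt I I'' k x k') (hfg : ∀ᶠ z in 𝓝 x, g (f z) = k z) (v : F) :
    g' (f' v) = k' v := by
  subst hy
  have h1 : HasMFDerivAt I I'' k x (g'.comp f') :=
    (HasMFDerivAt.comp x hg hf).congr_of_eventuallyEq (hfg.mono fun z hz => hz.symm)
  have := hasMFDerivAt_unique h1 hk
  exact congrArg (fun A : F →L[ℝ] F'' => A v) this

/-! ### Coordinates on `TQ` and `T(TQ)` induced by a chart of `Q` -/

section Charts

variable {E : Type*} [NormedAddCommGroup E] [NormedSpace ℝ E]
  {Q : Type*} [TopologicalSpace Q] [ChartedSpace E Q]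

lemma eventually_mem_target (q₀ : Q) {z : E × E} (hz : z.1 ∈ (extChartAt 𝓘(ℝ, E) q₀).target) :
    ∀ᶠ z' in 𝓝 z, z'.1 ∈ (extChartAt 𝓘(ℝ, E) q₀).target :=
  continuousAt_fst.eventually ((isOpen_extChartAt_target q₀).mem_nhds hz)

/-- The derivative of the inverse of the chart at `q₀`, read in the model space. -/
noncomputable def chartFrame (q₀ : Q) (x : E) : E →L[ℝ] E :=
  mfderiv 𝓘(ℝ, E) 𝓘(ℝ, E) (extChartAt 𝓘(ℝ, E) q₀).symm x

/-- The derivative of the chart at `q₀`, read in the model space. -/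
noncomputable def chartCoframe (q₀ : Q) (q : Q) : E →L[ℝ] E :=
  mfderiv 𝓘(ℝ, E) 𝓘(ℝ, E) (extChartAt 𝓘(ℝ, E) q₀) q

/-- The point of `TQ` with coordinates `z` in the chart at `q₀`. -/
noncomputable def chartPoint (q₀ : Q) (z : E × E) : TangentBundle 𝓘(ℝ, E) Q :=
  ⟨(extChartAt 𝓘(ℝ, E) q₀).symm z.1, chartFrame q₀ z.1 z.2⟩

variable [IsManifold 𝓘(ℝ, E) ∞ Q]

/-- The derivative of `chartPoint`, read in the model spaces. -/
noncomputable def chartPointDeriv (q₀ : Q) (z : E × E) : E × E →L[ℝ] E × E :=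
  mfderiv 𝓘(ℝ, E × E) 𝓘(ℝ, E).tangent (chartPoint q₀) z

/-- The preferred chart of `TQ` at `w₀` is the tangent map of the chart of `Q` at the base point.
This is what turns invariant objects on `TQ` into formulas in `(q, q̇)`. -/
lemma extChartAt_tangent_symm_apply (w₀ : TangentBundle 𝓘(ℝ, E) Q) {z : E × E}
    (hz : z.1 ∈ (extChartAt 𝓘(ℝ, E) w₀.1).target) :
    (extChartAt 𝓘(ℝ, E).tangent w₀).symm z = chartPoint w₀.1 z := by
  have := tangentMap_chart_symm (I := 𝓘(ℝ, E)) (p := w₀) (q := ⟨z.1, z.2⟩)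
    (by simpa using hz)
  exact this.symm

lemma extChartAt_tangent_apply (w₀ w : TangentBundle 𝓘(ℝ, E) Q)
    (hw : w.1 ∈ (extChartAt 𝓘(ℝ, E) w₀.1).source) :
    extChartAt 𝓘(ℝ, E).tangent w₀ w =
      (extChartAt 𝓘(ℝ, E) w₀.1 w.1, chartCoframe (E := E) w₀.1 w.1 w.2) := by
  have := tangentMap_chart (I := 𝓘(ℝ, E)) (p := w₀) (q := w)
    (by simpa using hw)
  exact (congrArg (TotalSpace.toProd E E) this).symm

lemma mem_extChartAt_tangent_target (w₀ : TangentBundle 𝓘(ℝ, E) Q) {z : E × E} :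
    z ∈ (extChartAt 𝓘(ℝ, E).tangent w₀).target ↔ z.1 ∈ (extChartAt 𝓘(ℝ, E) w₀.1).target := by
  rw [extChartAt_target, extChartAt_target, ModelWithCorners.range_eq_univ,
    ModelWithCorners.range_eq_univ, inter_univ, inter_univ]
  exact TangentBundle.mem_chart_target_iff (I := 𝓘(ℝ, E)) z w₀

/-- `TangentSpace` at `q` is identified with the model space by the preferred chart at `q` itself.
Computing at the centre of that chart therefore removes all frames from pointwise formulas. -/
lemma chartCoframe_self (q : Q) : chartCoframe q q = ContinuousLinearMap.id ℝ E :=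
  mfderiv_extChartAt_self (I := 𝓘(ℝ, E)) (x := q)

lemma extChartAt_tangent_self (q : Q) (v : E) :
    extChartAt 𝓘(ℝ, E).tangent (⟨q, v⟩ : TangentBundle 𝓘(ℝ, E) Q) ⟨q, v⟩ =
      (extChartAt 𝓘(ℝ, E) q q, v) := by
  rw [extChartAt_tangent_apply _ _ (mem_extChartAt_source _)]
  rw [chartCoframe_self]; rfl

lemma chartPoint_self (q : Q) (v : E) :
    chartPoint q (extChartAt 𝓘(ℝ, E) q q, v) = ⟨q, v⟩ := by
  rw [← extChartAt_tangent_self, ← extChartAt_tangent_symm_apply ⟨q, v⟩]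
  · exact extChartAt_to_inv _
  · rw [extChartAt_tangent_self]; exact mem_extChartAt_target q

lemma contMDiffAt_chartPoint (q₀ : Q) {z : E × E} (hz : z.1 ∈ (extChartAt 𝓘(ℝ, E) q₀).target) :
    ContMDiffAt 𝓘(ℝ, E × E) 𝓘(ℝ, E).tangent ∞ (chartPoint q₀) z := by
  -- The chart of `TQ` is the same at every vector over `q₀`, so the zero vector serves.
  have h1 : z ∈ (extChartAt 𝓘(ℝ, E).tangent (⟨q₀, 0⟩ : TangentBundle 𝓘(ℝ, E) Q)).target :=
    (mem_extChartAt_tangent_target _).2 hz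
  have h2 := contMDiffOn_extChartAt_symm (I := 𝓘(ℝ, E).tangent) (n := ∞)
    (⟨q₀, 0⟩ : TangentBundle 𝓘(ℝ, E) Q)
  have h3 : (extChartAt 𝓘(ℝ, E).tangent (⟨q₀, 0⟩ : TangentBundle 𝓘(ℝ, E) Q)).target ∈ 𝓝 z :=
    (isOpen_extChartAt_target _).mem_nhds h1
  refine (h2.contMDiffAt h3).congr_of_eventuallyEq ?_
  filter_upwards [h3] with z' hz'
  exact (extChartAt_tangent_symm_apply (⟨q₀, 0⟩ : TangentBundle 𝓘(ℝ, E) Q)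
    ((mem_extChartAt_tangent_target _).1 hz')).symm

lemma hasMFDerivAt_chartPoint (q₀ : Q) {z : E × E} (hz : z.1 ∈ (extChartAt 𝓘(ℝ, E) q₀).target) :
    HasMFDerivAt 𝓘(ℝ, E × E) 𝓘(ℝ, E).tangent (chartPoint q₀) z (chartPointDeriv (E := E) q₀ z) :=
  ((contMDiffAt_chartPoint q₀ hz).mdifferentiableAt (by simp)).hasMFDerivAt

lemma mfderiv_extChartAt_tangent_symm (w₀ : TangentBundle 𝓘(ℝ, E) Q) {z : E × E}
    (hz : z.1 ∈ (extChartAt 𝓘(ℝ, E) w₀.1).target) :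
    (mfderiv 𝓘(ℝ, E × E) 𝓘(ℝ, E).tangent (extChartAt 𝓘(ℝ, E).tangent w₀).symm z
      : E × E →L[ℝ] E × E) = chartPointDeriv w₀.1 z := by
  refine Filter.EventuallyEq.mfderiv_eq ?_
  filter_upwards [eventually_mem_target _ hz] with z' hz'
  exact extChartAt_tangent_symm_apply _ hz'

lemma hasMFDerivAt_chart_symm (q₀ : Q) {x : E} (hx : x ∈ (extChartAt 𝓘(ℝ, E) q₀).target) :
    HasMFDerivAt 𝓘(ℝ, E) 𝓘(ℝ, E) (extChartAt 𝓘(ℝ, E) q₀).symm x (chartFrame (E := E) q₀ x) := by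
  have := mdifferentiableWithinAt_extChartAt_symm (I := 𝓘(ℝ, E)) hx
  rw [modelWithCornersSelf_coe, range_id, mdifferentiableWithinAt_univ] at this
  exact this.hasMFDerivAt

lemma hasMFDerivAt_chart (q₀ : Q) {q : Q} (hq : q ∈ (extChartAt 𝓘(ℝ, E) q₀).source) :
    HasMFDerivAt 𝓘(ℝ, E) 𝓘(ℝ, E) (extChartAt 𝓘(ℝ, E) q₀) q (chartCoframe (E := E) q₀ q) :=
  (mdifferentiableAt_extChartAt (by simpa using hq)).hasMFDerivAt

lemma chartFrame_self (q : Q) :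
    chartFrame q (extChartAt 𝓘(ℝ, E) q q) = ContinuousLinearMap.id ℝ E := by
  have := mfderivWithin_range_extChartAt_symm (I := 𝓘(ℝ, E)) (x := q)
  rw [modelWithCornersSelf_coe, range_id, mfderivWithin_univ] at this
  exact this

lemma chartPointDeriv_self (q : Q) (v : E) :
    chartPointDeriv q (extChartAt 𝓘(ℝ, E) q q, v) = ContinuousLinearMap.id ℝ (E × E) := by
  have h := mfderivWithin_range_extChartAt_symm (I := 𝓘(ℝ, E).tangent)
    (x := (⟨q, v⟩ : TangentBundle 𝓘(ℝ, E) Q))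
  have h1 : range (𝓘(ℝ, E).tangent) = univ := ModelWithCorners.range_eq_univ _
  rw [h1, mfderivWithin_univ, extChartAt_tangent_self] at h
  exact (mfderiv_extChartAt_tangent_symm ⟨q, v⟩ (mem_extChartAt_target q)).symm.trans h

lemma chartFrame_chartCoframe (q₀ : Q) {q : Q} (hq : q ∈ (extChartAt 𝓘(ℝ, E) q₀).source) (v : E) :
    chartFrame q₀ (extChartAt 𝓘(ℝ, E) q₀ q) (chartCoframe q₀ q v) = v :=
  HasMFDerivAt.comp_apply_eq (k' := ContinuousLinearMap.id ℝ E)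
    (hasMFDerivAt_chart_symm q₀ ((extChartAt 𝓘(ℝ, E) q₀).map_source hq))
    (hasMFDerivAt_chart q₀ hq) rfl (hasMFDerivAt_id q)
    (eventually_of_mem ((isOpen_extChartAt_source q₀).mem_nhds hq)
      fun _ hz => (extChartAt 𝓘(ℝ, E) q₀).left_inv hz) v

lemma chartCoframe_chartFrame (q₀ : Q) {x : E} (hx : x ∈ (extChartAt 𝓘(ℝ, E) q₀).target) (v : E) :
    chartCoframe q₀ ((extChartAt 𝓘(ℝ, E) q₀).symm x) (chartFrame q₀ x v) = v :=
  HasMFDerivAt.comp_apply_eq (k' := ContinuousLinearMap.id ℝ E)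
    (hasMFDerivAt_chart q₀ ((extChartAt 𝓘(ℝ, E) q₀).map_target hx))
    (hasMFDerivAt_chart_symm q₀ hx) rfl (hasMFDerivAt_id x)
    (eventually_of_mem ((isOpen_extChartAt_target q₀).mem_nhds hx)
      fun _ hz => (extChartAt 𝓘(ℝ, E) q₀).right_inv hz) v

/-- The projection `τ_Q` in coordinates. -/
lemma tauDeriv_chartPointDeriv (q₀ : Q) {z : E × E}
    (hz : z.1 ∈ (extChartAt 𝓘(ℝ, E) q₀).target) (c : E × E) :
    tauDeriv (chartPoint q₀ z) (chartPointDeriv q₀ z c) = chartFrame q₀ z.1 c.1 := by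
  have hτ : MDifferentiableAt 𝓘(ℝ, E).tangent 𝓘(ℝ, E)
      (fun w : TangentBundle 𝓘(ℝ, E) Q => w.1) (chartPoint q₀ z) :=
    (contMDiff_proj (TangentSpace 𝓘(ℝ, E)) (n := 1) |>.contMDiffAt).mdifferentiableAt (by simp)
  exact HasMFDerivAt.comp_apply_eq (f' := chartPointDeriv q₀ z)
    (k' := (chartFrame q₀ z.1).comp (ContinuousLinearMap.fst ℝ E E))
    hτ.hasMFDerivAt (hasMFDerivAt_chartPoint q₀ hz) rfl
    (HasMFDerivAt.comp z (hasMFDerivAt_chart_symm q₀ hz) hasFDerivAt_fst.hasMFDerivAt)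
    (Eventually.of_forall fun z => rfl) c

lemma tauDeriv_mk (q : Q) (v : E) (U : E × E) :
    tauDeriv (⟨q, v⟩ : TangentBundle 𝓘(ℝ, E) Q) U = U.1 := by
  have h := tauDeriv_chartPointDeriv q (z := (extChartAt 𝓘(ℝ, E) q q, v))
    (mem_extChartAt_target q) U
  rw [chartPointDeriv_self, chartPoint_self, chartFrame_self] at h
  exact h

lemma mdifferentiableAt_fibre_inclusion (q : Q) (v : E) :
    MDifferentiableAt 𝓘(ℝ, E) 𝓘(ℝ, E).tangent
      (fun v : E => (⟨q, v⟩ : TangentBundle 𝓘(ℝ, E) Q)) v := by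
  have h1 : (fun v : E => (⟨q, v⟩ : TangentBundle 𝓘(ℝ, E) Q)) =
      chartPoint q ∘ fun v : E => (extChartAt 𝓘(ℝ, E) q q, v) := by
    funext v; exact (chartPoint_self q v).symm
  rw [h1]
  exact MDifferentiableAt.comp (I' := 𝓘(ℝ, E × E)) v
    (hasMFDerivAt_chartPoint q (mem_extChartAt_target q)).mdifferentiableAt
    (differentiableAt_const _ |>.prodMk differentiableAt_id).mdifferentiableAt

/-- The vertical lift in coordinates. -/
lemma vertLift_chartFrame (q₀ : Q) {z : E × E} (hz : z.1 ∈ (extChartAt 𝓘(ℝ, E) q₀).target)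
    (c : E) :
    vertLift (chartPoint q₀ z) (chartFrame q₀ z.1 c) = chartPointDeriv q₀ z (0, c) := by
  have h1 := HasMFDerivAt.comp z.2 (mdifferentiableAt_fibre_inclusion
    ((extChartAt 𝓘(ℝ, E) q₀).symm z.1) (chartFrame q₀ z.1 z.2)).hasMFDerivAt
      ((chartFrame q₀ z.1).hasFDerivAt (x := z.2)).hasMFDerivAt
  exact (HasMFDerivAt.comp_apply_eq (g' := chartPointDeriv q₀ z)
    (f' := ContinuousLinearMap.inr ℝ E E)
    (hasMFDerivAt_chartPoint q₀ hz) (f := fun v : E => (z.1, v)) (x := z.2)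
    (hasFDerivAt_prodMk_right z.1 z.2).hasMFDerivAt rfl h1
    (Eventually.of_forall fun v => rfl) c).symm

lemma vertEndo_chartPointDeriv (q₀ : Q) {z : E × E} (hz : z.1 ∈ (extChartAt 𝓘(ℝ, E) q₀).target)
    (c : E × E) :
    vertEndo (chartPoint q₀ z) (chartPointDeriv q₀ z c) = chartPointDeriv q₀ z (0, c.1) := by
  rw [← vertLift_chartFrame q₀ hz, ← tauDeriv_chartPointDeriv q₀ hz]; rfl

lemma liouville_chartPoint (q₀ : Q) {z : E × E} (hz : z.1 ∈ (extChartAt 𝓘(ℝ, E) q₀).target) :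
    liouville (chartPoint q₀ z) = chartPointDeriv q₀ z (0, z.2) :=
  vertLift_chartFrame q₀ hz z.2

end Charts

/-! ### The Poincaré–Cartan form, the energy and the forced equation in coordinates -/

section Lagrangian

variable {E : Type*} [NormedAddCommGroup E] [NormedSpace ℝ E]
  {Q : Type*} [TopologicalSpace Q] [ChartedSpace E Q]

/-- A function on `TQ` in the coordinates given by the chart at `q₀`. -/
noncomputable def localRep (L : TangentBundle 𝓘(ℝ, E) Q → ℝ) (q₀ : Q) : E × E → ℝ :=
  fun z => L (chartPoint q₀ z)

variable [IsManifold 𝓘(ℝ, E) ∞ Q] {L : TangentBundle 𝓘(ℝ, E) Q → ℝ}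

lemma contDiffAt_localRep
    (hL : ContMDiff 𝓘(ℝ, E).tangent 𝓘(ℝ, ℝ) ∞ L) (q₀ : Q) {z : E × E}
    (hz : z.1 ∈ (extChartAt 𝓘(ℝ, E) q₀).target) : ContDiffAt ℝ ∞ (localRep L q₀) z :=
  (hL.contMDiffAt.comp z (contMDiffAt_chartPoint q₀ hz)).contDiffAt

end Lagrangian

section LagrangianCoordinates

variable {E : Type*} [NormedAddCommGroup E] [NormedSpace ℝ E]
  {Q : Type*} [TopologicalSpace Q] [ChartedSpace E Q] [IsManifold 𝓘(ℝ, E) ∞ Q]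
  {L : TangentBundle 𝓘(ℝ, E) Q → ℝ}

lemma localRep_extChartAt_eventuallyEq (f : TangentBundle 𝓘(ℝ, E) Q → ℝ) (q : Q) (v : E) :
    ∀ᶠ w in 𝓝 (⟨q, v⟩ : TangentBundle 𝓘(ℝ, E) Q),
      localRep f q (extChartAt 𝓘(ℝ, E).tangent (⟨q, v⟩ : TangentBundle 𝓘(ℝ, E) Q) w) = f w := by
  filter_upwards [extChartAt_source_mem_nhds (I := 𝓘(ℝ, E).tangent)
    (⟨q, v⟩ : TangentBundle 𝓘(ℝ, E) Q)] with w hw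
  have h1 := (extChartAt 𝓘(ℝ, E).tangent (⟨q, v⟩ : TangentBundle 𝓘(ℝ, E) Q)).map_source hw
  rw [localRep, ← extChartAt_tangent_symm_apply (⟨q, v⟩ : TangentBundle 𝓘(ℝ, E) Q)
    ((mem_extChartAt_tangent_target _).1 h1), PartialEquiv.left_inv _ hw]

lemma hasMFDerivAt_extChartAt_tangent_self (q : Q) (v : E) :
    HasMFDerivAt 𝓘(ℝ, E).tangent 𝓘(ℝ, E × E)
      (extChartAt 𝓘(ℝ, E).tangent (⟨q, v⟩ : TangentBundle 𝓘(ℝ, E) Q)) ⟨q, v⟩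
      (ContinuousLinearMap.id ℝ (E × E)) := by
  have h := (mdifferentiableAt_extChartAt (I := 𝓘(ℝ, E).tangent)
    (mem_chart_source _ (⟨q, v⟩ : TangentBundle 𝓘(ℝ, E) Q))).hasMFDerivAt
  rw [mfderiv_extChartAt_self] at h
  exact h

/-- The differential of a function on `TQ` in coordinates. -/
lemma tdiff_eq_fderiv_localRep {f : TangentBundle 𝓘(ℝ, E) Q → ℝ} {q : Q} {v : E}
    (hf : DifferentiableAt ℝ (localRep f q) (extChartAt 𝓘(ℝ, E) q q, v)) (c : E × E) :
    tdiff f ⟨q, v⟩ c = fderiv ℝ (localRep f q) (extChartAt 𝓘(ℝ, E) q q, v) c := by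
  have h1 : HasMFDerivAt 𝓘(ℝ, E × E) 𝓘(ℝ, ℝ) (localRep f q)
      (extChartAt 𝓘(ℝ, E).tangent (⟨q, v⟩ : TangentBundle 𝓘(ℝ, E) Q) ⟨q, v⟩)
      (fderiv ℝ (localRep f q) (extChartAt 𝓘(ℝ, E) q q, v)) := by
    rw [extChartAt_tangent_self]; exact hf.hasFDerivAt.hasMFDerivAt
  have h2 : HasMFDerivAt 𝓘(ℝ, E).tangent 𝓘(ℝ, ℝ) f ⟨q, v⟩
      ((fderiv ℝ (localRep f q) (extChartAt 𝓘(ℝ, E) q q, v)).comp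
        (ContinuousLinearMap.id ℝ (E × E))) :=
    (HasMFDerivAt.comp _ h1 (hasMFDerivAt_extChartAt_tangent_self q v)).congr_of_eventuallyEq
      ((localRep_extChartAt_eventuallyEq f q v).mono fun _ h => h.symm)
  rw [tdiff, h2.mfderiv]; rfl

lemma contMDiff_of_localRep {f : TangentBundle 𝓘(ℝ, E) Q → ℝ}
    (hf : ∀ (q : Q) (v : E), ContDiffAt ℝ ∞ (localRep f q) (extChartAt 𝓘(ℝ, E) q q, v)) :
    ContMDiff 𝓘(ℝ, E).tangent 𝓘(ℝ, ℝ) ∞ f := by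
  rintro ⟨q, v⟩
  have h1 : ContMDiffAt 𝓘(ℝ, E × E) 𝓘(ℝ, ℝ) ∞ (localRep f q)
      (extChartAt 𝓘(ℝ, E).tangent (⟨q, v⟩ : TangentBundle 𝓘(ℝ, E) Q) ⟨q, v⟩) := by
    erw [extChartAt_tangent_self]; exact (hf q v).contMDiffAt
  have h2 : ContMDiffAt 𝓘(ℝ, E).tangent 𝓘(ℝ, E × E) ∞
      (extChartAt 𝓘(ℝ, E).tangent (⟨q, v⟩ : TangentBundle 𝓘(ℝ, E) Q)) ⟨q, v⟩ :=
    contMDiffAt_extChartAt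
  exact (h1.comp _ h2).congr_of_eventuallyEq
    ((localRep_extChartAt_eventuallyEq f q v).mono fun _ h => h.symm)

lemma legendre_eq_fderiv_localRep {q : Q} {v : E}
    (hL : DifferentiableAt ℝ (localRep L q) (extChartAt 𝓘(ℝ, E) q q, v)) (c : E) :
    legendre L ⟨q, v⟩ c = fderiv ℝ (localRep L q) (extChartAt 𝓘(ℝ, E) q q, v) (0, c) := by
  have h1 : (fun v : E => L (⟨q, v⟩ : TangentBundle 𝓘(ℝ, E) Q)) =
      fun v => localRep L q (extChartAt 𝓘(ℝ, E) q q, v) := by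
    funext v; rw [localRep, chartPoint_self]
  have h2 := HasFDerivAt.comp v hL.hasFDerivAt
    (hasFDerivAt_prodMk_right (𝕜 := ℝ) (extChartAt 𝓘(ℝ, E) q q) v)
  change fderiv ℝ (fun v : E => L (⟨q, v⟩ : TangentBundle 𝓘(ℝ, E) Q)) v c = _
  rw [h1]
  exact congrArg (fun A : E →L[ℝ] ℝ => A c) h2.fderiv

lemma tdiff_chartPointDeriv (hL : ContMDiff 𝓘(ℝ, E).tangent 𝓘(ℝ, ℝ) ∞ L) (q₀ : Q) {z : E × E}
    (hz : z.1 ∈ (extChartAt 𝓘(ℝ, E) q₀).target) (c : E × E) :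
    tdiff L (chartPoint q₀ z) (chartPointDeriv q₀ z c) = fderiv ℝ (localRep L q₀) z c :=
  HasMFDerivAt.comp_apply_eq
    ((hL.mdifferentiable (by simp)).mdifferentiableAt (x := chartPoint q₀ z)).hasMFDerivAt
    (hasMFDerivAt_chartPoint q₀ hz) rfl
    ((contDiffAt_localRep hL q₀ hz).differentiableAt (by simp)).hasFDerivAt.hasMFDerivAt
    (Eventually.of_forall fun _ => rfl) c

/-- This is `α_L = (∂L/∂q̇) dq`, because `S` sends `(a, b)` to `(0, a)`. It is needed on a whole
neighbourhood since it is about to be differentiated. -/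
lemma formInChart_cartanOneForm (hL : ContMDiff 𝓘(ℝ, E).tangent 𝓘(ℝ, ℝ) ∞ L) (q : Q) (v : E) :
    ∀ᶠ z in 𝓝 (extChartAt 𝓘(ℝ, E) q q, v),
      formInChart 𝓘(ℝ, E).tangent (cartanOneForm L) (⟨q, v⟩ : TangentBundle 𝓘(ℝ, E) Q) z =
        (fderiv ℝ (localRep L q) z).comp
          ((ContinuousLinearMap.inr ℝ E E).comp (ContinuousLinearMap.fst ℝ E E)) := by
  filter_upwards [eventually_mem_target q (z := (extChartAt 𝓘(ℝ, E) q q, v))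
    (mem_extChartAt_target q)] with z hz
  refine ContinuousLinearMap.ext fun c => ?_
  -- Point and derivative are generalised together so that both can be substituted despite the
  -- dependent types.
  have key : ∀ w : TangentBundle 𝓘(ℝ, E) Q, w = chartPoint q z → ∀ A : E × E →L[ℝ] E × E,
      A = chartPointDeriv q z → cartanOneForm L w (A c) = fderiv ℝ (localRep L q) z (0, c.1) := by
    rintro _ rfl _ rfl
    rw [← tdiff_chartPointDeriv hL q hz, ← vertEndo_chartPointDeriv q hz]; rfl
  exact key _ (extChartAt_tangent_symm_apply ⟨q, v⟩ hz) _
    (mfderiv_extChartAt_tangent_symm ⟨q, v⟩ hz)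

/-- The second derivative of the local representative of a lagrangian, at the point with
coordinates `z`. -/
noncomputable def localHess (L : TangentBundle 𝓘(ℝ, E) Q → ℝ) (q : Q) (z : E × E) :
    E × E →L[ℝ] E × E →L[ℝ] ℝ :=
  fderiv ℝ (fun z => fderiv ℝ (localRep L q) z) z

lemma hasFDerivAt_fderiv_localRep (hL : ContMDiff 𝓘(ℝ, E).tangent 𝓘(ℝ, ℝ) ∞ L) (q : Q) {z : E × E}
    (hz : z.1 ∈ (extChartAt 𝓘(ℝ, E) q).target) :
    HasFDerivAt (fun z => fderiv ℝ (localRep L q) z) (localHess L q z) z :=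
  (((contDiffAt_localRep hL q hz).fderiv_right (m := 1) (by norm_cast)).differentiableAt
    (by simp)).hasFDerivAt

lemma localHess_symm (hL : ContMDiff 𝓘(ℝ, E).tangent 𝓘(ℝ, ℝ) ∞ L) (q : Q) {z : E × E}
    (hz : z.1 ∈ (extChartAt 𝓘(ℝ, E) q).target) (a b : E × E) :
    localHess L q z a b = localHess L q z b a :=
  ((contDiffAt_localRep hL q hz).isSymmSndFDerivAt
    (by simpa using ENat.LEInfty.out)) a b

/-- The derivative of `α_L` in direction `a`, applied to `b`, is `D²L(a)(0, b.1)`; antisymmetrising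
and changing sign gives `ω_L`. -/
lemma cartanTwoForm_eq (hL : ContMDiff 𝓘(ℝ, E).tangent 𝓘(ℝ, ℝ) ∞ L) (q : Q) (v : E)
    (Z U : E × E) :
    cartanTwoForm L ⟨q, v⟩ Z U =
      localHess L q (extChartAt 𝓘(ℝ, E) q q, v) U (0, Z.1) -
      localHess L q (extChartAt 𝓘(ℝ, E) q q, v) Z (0, U.1) := by
  have h1 : HasFDerivAt (formInChart 𝓘(ℝ, E).tangent (cartanOneForm L)
      (⟨q, v⟩ : TangentBundle 𝓘(ℝ, E) Q)) _ (extChartAt 𝓘(ℝ, E) q q, v) :=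
    HasFDerivAt.congr_of_eventuallyEq
      ((hasFDerivAt_fderiv_localRep hL q (z := (extChartAt 𝓘(ℝ, E) q q, v))
        (mem_extChartAt_target q)).clm_comp (hasFDerivAt_const
          ((ContinuousLinearMap.inr ℝ E E).comp (ContinuousLinearMap.fst ℝ E E)) _))
      (formInChart_cartanOneForm hL q v)
  have h2 : ∀ a b : E × E, fderiv ℝ (formInChart 𝓘(ℝ, E).tangent (cartanOneForm L)
      (⟨q, v⟩ : TangentBundle 𝓘(ℝ, E) Q))
      (extChartAt 𝓘(ℝ, E).tangent (⟨q, v⟩ : TangentBundle 𝓘(ℝ, E) Q) ⟨q, v⟩) a b =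
      localHess L q (extChartAt 𝓘(ℝ, E) q q, v) a (0, b.1) := by
    intro a b
    rw [extChartAt_tangent_self, h1.fderiv]
    simp
  have h3 : ∀ u : E × E, (mfderiv 𝓘(ℝ, E).tangent 𝓘(ℝ, E × E)
      (extChartAt 𝓘(ℝ, E).tangent (⟨q, v⟩ : TangentBundle 𝓘(ℝ, E) Q)) ⟨q, v⟩
        : E × E →L[ℝ] E × E) u = u := fun u => by
    rw [(hasMFDerivAt_extChartAt_tangent_self q v).mfderiv]; rfl
  have h4 : cartanTwoForm L ⟨q, v⟩ Z U = -(localHess L q (extChartAt 𝓘(ℝ, E) q q, v) Z (0, U.1) -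
      localHess L q (extChartAt 𝓘(ℝ, E) q q, v) U (0, Z.1)) := by
    rw [← h2, ← h2]
    conv_rhs => rw [← h3 Z, ← h3 U]
    rfl
  rw [h4, neg_sub]

lemma localRep_energy (hL : ContMDiff 𝓘(ℝ, E).tangent 𝓘(ℝ, ℝ) ∞ L) (q : Q) {z : E × E}
    (hz : z.1 ∈ (extChartAt 𝓘(ℝ, E) q).target) :
    localRep (energy L) q z = fderiv ℝ (localRep L q) z (0, z.2) - localRep L q z := by
  rw [← tdiff_chartPointDeriv hL q hz, ← liouville_chartPoint q hz]; rfl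

/-- With `E_L = (∂L/∂q̇) q̇ - L`, the two terms `(∂L/∂q̇) dq̇` cancel, so only the base derivative
of `L` remains besides the Hessian. -/
lemma tdiff_energy (hL : ContMDiff 𝓘(ℝ, E).tangent 𝓘(ℝ, ℝ) ∞ L) (q : Q) (v : E) (U : E × E) :
    tdiff (energy L) ⟨q, v⟩ U =
      localHess L q (extChartAt 𝓘(ℝ, E) q q, v) U (0, v) -
      fderiv ℝ (localRep L q) (extChartAt 𝓘(ℝ, E) q q, v) (U.1, 0) := by
  have hz : (extChartAt 𝓘(ℝ, E) q q, v).1 ∈ (extChartAt 𝓘(ℝ, E) q).target :=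
    mem_extChartAt_target q
  have h1 := ((hasFDerivAt_fderiv_localRep hL q hz).clm_apply
    ((ContinuousLinearMap.inr ℝ E E).comp (ContinuousLinearMap.snd ℝ E E)).hasFDerivAt).sub
    ((contDiffAt_localRep hL q hz).differentiableAt (by simp)).hasFDerivAt
  have h2 := h1.congr_of_eventuallyEq (f₁ := localRep (energy L) q)
    ((eventually_mem_target q hz).mono fun z hz => localRep_energy hL q hz)
  rw [tdiff_eq_fderiv_localRep h2.differentiableAt, h2.fderiv]
  have h3 : U = (U.1, 0) + (0, U.2) := by simp
  have h4 := congrArg (fderiv ℝ (localRep L q) (extChartAt 𝓘(ℝ, E) q q, v)) h3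
  rw [map_add] at h4
  simp only [sub_apply, add_apply,
    ContinuousLinearMap.comp_apply, ContinuousLinearMap.flip_apply,
    ContinuousLinearMap.inr_apply, ContinuousLinearMap.coe_snd', h4]
  ring

/-- The equation `i_Z ω_L = dE_L + f` for a semibasic force, in coordinates. -/
lemma forced_equation_iff (hL : ContMDiff 𝓘(ℝ, E).tangent 𝓘(ℝ, ℝ) ∞ L) (q : Q) (v : E)
    (hnd : ∀ b : E, (∀ c : E,
      localHess L q (extChartAt 𝓘(ℝ, E) q q, v) (0, b) (0, c) = 0) → b = 0)
    (f : E → ℝ) (hf : f 0 = 0) (Z : E × E) :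
    (∀ U : E × E, cartanTwoForm L ⟨q, v⟩ Z U = tdiff (energy L) ⟨q, v⟩ U + f U.1) ↔
      Z.1 = v ∧ ∀ c, localHess L q (extChartAt 𝓘(ℝ, E) q q, v) Z (0, c) =
        fderiv ℝ (localRep L q) (extChartAt 𝓘(ℝ, E) q q, v) (c, 0) - f c := by
  simp only [cartanTwoForm_eq hL, tdiff_energy hL]
  constructor
  · intro h
    have h1 : Z.1 = v := by
      -- Testing the equation on vertical vectors `(0, c)` forces the second-order condition;
      -- testing on `(c, 0)` below then gives the forced Euler–Lagrange equation.
      refine sub_eq_zero.1 (hnd _ fun c => ?_)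
      rw [localHess_symm hL q (mem_extChartAt_target q)]
      have h2 := h (0, c)
      have h3 : ((0, Z.1 - v) : E × E) = (0, Z.1) - (0, v) := by simp
      have h4 : ((0, 0) : E × E) = 0 := rfl
      rw [h3, map_sub]
      simp only [h4, map_zero, hf] at h2
      linarith
    refine ⟨h1, fun c => ?_⟩
    have h2 := h (c, 0)
    simp only [h1] at h2
    linarith
  · rintro ⟨h1, h2⟩ U
    rw [h2, h1]; ring

end LagrangianCoordinates

/-! ### Constraint tangent spaces, reaction forces and the nonholonomic dynamics -/

section Nonholonomic

variable {E : Type*} [NormedAddCommGroup E] [NormedSpace ℝ E]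
  {Q : Type*} [TopologicalSpace Q] [ChartedSpace E Q] [IsManifold 𝓘(ℝ, E) ∞ Q]
  {L : TangentBundle 𝓘(ℝ, E) Q → ℝ}
  {h : (q : Q) → TangentSpace 𝓘(ℝ, E) q →L[ℝ] TangentSpace 𝓘(ℝ, E) q}

/-- The tangent space of the constraint submanifold in coordinates, `K` being the expression of
the projector `h`. -/
lemma mem_constraintTangent_iff {q : Q} {v : E} {K : E → E →L[ℝ] E} {K' : E →L[ℝ] E →L[ℝ] E}
    (hK : HasFDerivAt K K' (extChartAt 𝓘(ℝ, E) q q))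
    (hproj : ∀ᶠ x in 𝓝 (extChartAt 𝓘(ℝ, E) q q), ∀ v : E,
      projMap h (chartPoint q (x, v)) = chartPoint q (x, K x v))
    (hv : K (extChartAt 𝓘(ℝ, E) q q) v = v) (Z : E × E) :
    Z ∈ constraintTangent h ⟨q, v⟩ ↔
      ∃ a b : E, Z = (a, K' a v + K (extChartAt 𝓘(ℝ, E) q q) b) := by
  set x₀ := extChartAt 𝓘(ℝ, E) q q with hx₀
  -- In coordinates the retraction onto the constraint is `(x, v) ↦ (x, K x v)`; its derivative at a
  -- point fixed by it parametrises the tangent space.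
  obtain ⟨D, h1, hD⟩ : ∃ D : E × E →L[ℝ] E × E,
      HasFDerivAt (fun z : E × E => (z.1, K z.1 z.2)) D (x₀, v) ∧
      ∀ c, D c = (c.1, K' c.1 v + K x₀ c.2) :=
    ⟨_, hasFDerivAt_fst.prodMk ((HasFDerivAt.comp (x₀, v) (g := K) hK hasFDerivAt_fst).clm_apply
      hasFDerivAt_snd), fun c => Prod.ext rfl (add_comm _ _)⟩
  have hv' : ((fun z : E × E => (z.1, K z.1 z.2)) (x₀, v)) = (x₀, v) := by simp [hv]
  have h2 : HasMFDerivAt 𝓘(ℝ, E × E) 𝓘(ℝ, E).tangent (chartPoint q)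
      ((fun z : E × E => (z.1, K z.1 z.2)) (x₀, v)) (ContinuousLinearMap.id ℝ (E × E)) := by
    rw [hv', ← chartPointDeriv_self q v]
    exact hasMFDerivAt_chartPoint q (mem_extChartAt_target q)
  have h3 := HasMFDerivAt.comp (x₀, v) h2 h1.hasMFDerivAt
  have h4 : HasMFDerivAt 𝓘(ℝ, E × E) 𝓘(ℝ, E).tangent
      (chartPoint q ∘ fun z : E × E => (z.1, K z.1 z.2))
      (extChartAt 𝓘(ℝ, E).tangent (⟨q, v⟩ : TangentBundle 𝓘(ℝ, E) Q) ⟨q, v⟩) D := by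
    rw [extChartAt_tangent_self]; exact h3
  have h5 := HasMFDerivAt.comp _ h4 (hasMFDerivAt_extChartAt_tangent_self q v)
  have h6 := h5.congr_of_eventuallyEq (f₁ := projMap h) (by
    have h7 : ContinuousAt (fun w : TangentBundle 𝓘(ℝ, E) Q => extChartAt 𝓘(ℝ, E) q w.1)
        ⟨q, v⟩ :=
      ContinuousAt.comp (g := extChartAt 𝓘(ℝ, E) q) (continuousAt_extChartAt (I := 𝓘(ℝ, E)) q)
        (FiberBundle.continuous_proj E (TangentSpace 𝓘(ℝ, E))).continuousAt
    filter_upwards [h7.eventually hproj, extChartAt_source_mem_nhds (I := 𝓘(ℝ, E).tangent)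
      (⟨q, v⟩ : TangentBundle 𝓘(ℝ, E) Q)] with w hw1 hw2
    have h8 := (extChartAt 𝓘(ℝ, E).tangent (⟨q, v⟩ : TangentBundle 𝓘(ℝ, E) Q)).map_source hw2
    have h9 := (extChartAt 𝓘(ℝ, E).tangent (⟨q, v⟩ : TangentBundle 𝓘(ℝ, E) Q)).left_inv hw2
    rw [extChartAt_tangent_symm_apply _ ((mem_extChartAt_tangent_target _).1 h8)] at h9
    have h10 := hw1 (extChartAt 𝓘(ℝ, E).tangent (⟨q, v⟩ : TangentBundle 𝓘(ℝ, E) Q) w).2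
    exact (congrArg (projMap h) h9).symm.trans h10)
  have h7 : ∀ Z' : E × E, mfderiv 𝓘(ℝ, E).tangent 𝓘(ℝ, E).tangent (projMap h) ⟨q, v⟩ Z' =
      (Z'.1, K' Z'.1 v + K x₀ Z'.2) := fun Z' => by
    rw [h6.mfderiv]
    exact hD Z'
  constructor
  · rintro ⟨Z', rfl⟩
    exact ⟨Z'.1, Z'.2, h7 Z'⟩
  · rintro ⟨a, b, rfl⟩
    exact ⟨(a, b), (h7 (a, b)).symm⟩

/-- D'Alembert's principle in coordinates: a covector on the base that kills the constraint
distribution, pulled back to `TQ`, is an admissible reaction force. -/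
lemma mem_reactionForces_of {q : Q} {v : E} {K : E → E →L[ℝ] E} {K' : E →L[ℝ] E →L[ℝ] E}
    (hK : HasFDerivAt K K' (extChartAt 𝓘(ℝ, E) q q))
    (hproj : ∀ᶠ x in 𝓝 (extChartAt 𝓘(ℝ, E) q q), ∀ v : E,
      projMap h (chartPoint q (x, v)) = chartPoint q (x, K x v))
    (hv : K (extChartAt 𝓘(ℝ, E) q q) v = v) (γ : E →L[ℝ] ℝ)
    (hγ : ∀ b, γ (K (extChartAt 𝓘(ℝ, E) q q) b) = 0) :
    ∃ F ∈ reactionForces h (⟨q, v⟩ : TangentBundle 𝓘(ℝ, E) Q), ∀ U : E × E, F U = γ U.1 := by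
  -- Subtracting `K' a v` removes the part of a tangent vector forced by the variation of the
  -- constraint and leaves `K b`, which `γ` kills. On the image `(0, a)` of `S` the correction
  -- vanishes.
  let β : E × E →L[ℝ] ℝ := γ.comp (ContinuousLinearMap.snd ℝ E E -
    (K'.flip v).comp (ContinuousLinearMap.fst ℝ E E))
  have hS : ∀ U : E × E, vertEndo (⟨q, v⟩ : TangentBundle 𝓘(ℝ, E) Q) U = (0, U.1) := fun U => by
    have := vertEndo_chartPointDeriv q (z := (extChartAt 𝓘(ℝ, E) q q, v))
      (mem_extChartAt_target q) U
    rw [chartPointDeriv_self, chartPoint_self] at this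
    exact this
  refine ⟨ContinuousLinearMap.comp (M₂ := E × E) β (vertEndo ⟨q, v⟩), ⟨β, ?_, rfl⟩, fun U => ?_⟩
  · intro Z hZ
    obtain ⟨a, b, rfl⟩ := (mem_constraintTangent_iff hK hproj hv Z).1 hZ
    change γ (K' a v + K (extChartAt 𝓘(ℝ, E) q q) b - K' a v) = 0
    rw [add_sub_cancel_left, hγ]
  · change β (vertEndo (⟨q, v⟩ : TangentBundle 𝓘(ℝ, E) Q) U) = _
    rw [hS]
    simp [β]

lemma cartanTwoForm_sub_left (w : TangentBundle 𝓘(ℝ, E) Q) (Z₁ Z₂ U : TangentSpace 𝓘(ℝ, E).tangent w) :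
    cartanTwoForm L w (Z₁ - Z₂) U = cartanTwoForm L w Z₁ U - cartanTwoForm L w Z₂ U := by
  have key : ∀ (A : E × E →L[ℝ] E × E →L[ℝ] ℝ) (B : E × E →L[ℝ] E × E) (Z₁ Z₂ U : E × E),
      -(A (B (Z₁ - Z₂)) (B U) - A (B U) (B (Z₁ - Z₂))) =
        -(A (B Z₁) (B U) - A (B U) (B Z₁)) - -(A (B Z₂) (B U) - A (B U) (B Z₂)) := by
    intro A B Z₁ Z₂ U
    simp only [map_sub, sub_apply]
    ring
  exact key _ _ _ _ _

/-- Uniqueness of the nonholonomic dynamics. -/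
lemma nonholonomicDynamics_eq (hcompat : IsCompatible L h)
    {w : TangentBundle 𝓘(ℝ, E) Q} (hw : w ∈ constraintSet h)
    {Z : TangentSpace 𝓘(ℝ, E).tangent w} (hZ : Z ∈ constraintTangent h w)
    (hF : ∃ F ∈ reactionForces h w, ∀ U, cartanTwoForm L w Z U - tdiff (energy L) w U = F U) :
    nonholonomicDynamics L h w = Z := by
  obtain ⟨h1, F₁, hF₁, h2⟩ := Classical.epsilon_spec
    (p := fun Z => Z ∈ constraintTangent h w ∧
      ∃ F ∈ reactionForces h w, ∀ U, cartanTwoForm L w Z U - tdiff (energy L) w U = F U)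
    ⟨Z, hZ, hF⟩
  obtain ⟨F, hF, h3⟩ := hF
  -- The difference of two solutions is tangent to the constraint and its contraction with `ω_L` is
  -- a difference of reaction forces, so compatibility makes it zero.
  refine sub_eq_zero.1 (hcompat w hw _ ?_ ⟨F₁ - F, ?_, fun U => ?_⟩)
  · obtain ⟨a, ha⟩ := h1
    obtain ⟨b, hb⟩ := hZ
    refine ⟨a - b, ?_⟩
    rw [map_sub, ← ha, ← hb]; rfl
  · obtain ⟨β₁, hβ₁, rfl⟩ := hF₁
    obtain ⟨β, hβ, rfl⟩ := hF
    refine ⟨β₁ - β, fun Z hZ => ?_, ?_⟩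
    · rw [sub_apply, hβ₁ Z hZ, hβ Z hZ, sub_zero]
    · rw [ContinuousLinearMap.sub_comp]
  · rw [sub_apply, ← h2, ← h3, cartanTwoForm_sub_left]
    change _ = cartanTwoForm L w (nonholonomicDynamics L h w) U - _ - _
    ring

/-- The nonholonomic dynamics in coordinates. -/
lemma nonholonomicDynamics_eq_of_coordinates (hL : ContMDiff 𝓘(ℝ, E).tangent 𝓘(ℝ, ℝ) ∞ L)
    (hcompat : IsCompatible L h)
    {q : Q} {v : E} {K : E → E →L[ℝ] E} {K' : E →L[ℝ] E →L[ℝ] E}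
    (hK : HasFDerivAt K K' (extChartAt 𝓘(ℝ, E) q q))
    (hproj : ∀ᶠ x in 𝓝 (extChartAt 𝓘(ℝ, E) q q), ∀ v : E,
      projMap h (chartPoint q (x, v)) = chartPoint q (x, K x v))
    (hv : K (extChartAt 𝓘(ℝ, E) q q) v = v)
    (hw : (⟨q, v⟩ : TangentBundle 𝓘(ℝ, E) Q) ∈ constraintSet h) (b : E)
    (heq : ∀ c, localHess L q (extChartAt 𝓘(ℝ, E) q q, v)
        (v, K' v v + K (extChartAt 𝓘(ℝ, E) q q) b) (0, K (extChartAt 𝓘(ℝ, E) q q) c) =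
      fderiv ℝ (localRep L q) (extChartAt 𝓘(ℝ, E) q q, v)
        (K (extChartAt 𝓘(ℝ, E) q q) c, 0)) :
    nonholonomicDynamics L h ⟨q, v⟩ = (v, K' v v + K (extChartAt 𝓘(ℝ, E) q q) b) := by
  refine nonholonomicDynamics_eq hcompat hw
    ((mem_constraintTangent_iff hK hproj hv _).2 ⟨v, b, rfl⟩) ?_
  -- For a vector with first component `v`, the defect `i_Z ω_L - dE_L` is the Euler–Lagrange defect
  -- of `Z`, a semibasic covector; `heq` says that it kills the constraint distribution.
  obtain ⟨F, hF, hFU⟩ := mem_reactionForces_of hK hproj hv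
    ((fderiv ℝ (localRep L q) (extChartAt 𝓘(ℝ, E) q q, v)).comp (ContinuousLinearMap.inl ℝ E E) -
      (localHess L q (extChartAt 𝓘(ℝ, E) q q, v)
        (v, K' v v + K (extChartAt 𝓘(ℝ, E) q q) b)).comp (ContinuousLinearMap.inr ℝ E E))
    (fun c => by simpa using sub_eq_zero.2 (heq c).symm)
  refine ⟨F, hF, fun (U : E × E) => ?_⟩
  rw [hFU, cartanTwoForm_eq hL, tdiff_energy hL]
  simp

/-- Under the compatibility condition the vertical Hessian is nondegenerate on the constraint
distribution. -/
lemma eq_zero_of_localHess_eq_zero (hL : ContMDiff 𝓘(ℝ, E).tangent 𝓘(ℝ, ℝ) ∞ L)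
    (hcompat : IsCompatible L h)
    {q : Q} {v : E} {K : E → E →L[ℝ] E} {K' : E →L[ℝ] E →L[ℝ] E}
    (hK : HasFDerivAt K K' (extChartAt 𝓘(ℝ, E) q q))
    (hproj : ∀ᶠ x in 𝓝 (extChartAt 𝓘(ℝ, E) q q), ∀ v : E,
      projMap h (chartPoint q (x, v)) = chartPoint q (x, K x v))
    (hv : K (extChartAt 𝓘(ℝ, E) q q) v = v)
    (hw : (⟨q, v⟩ : TangentBundle 𝓘(ℝ, E) Q) ∈ constraintSet h) (b : E)
    (heq : ∀ c, localHess L q (extChartAt 𝓘(ℝ, E) q q, v)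
        (0, K (extChartAt 𝓘(ℝ, E) q q) b) (0, K (extChartAt 𝓘(ℝ, E) q q) c) = 0) :
    K (extChartAt 𝓘(ℝ, E) q q) b = 0 := by
  have h1 : ((0, K (extChartAt 𝓘(ℝ, E) q q) b) : E × E) = 0 := by
    -- The vertical vector `(0, K b)` is tangent to the constraint, and its contraction with `ω_L`
    -- is semibasic; by `heq` this contraction is a reaction force.
    refine hcompat ⟨q, v⟩ hw _ ((mem_constraintTangent_iff hK hproj hv _).2 ⟨0, b, by simp⟩) ?_
    obtain ⟨F, hF, hFU⟩ := mem_reactionForces_of hK hproj hv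
      (-(localHess L q (extChartAt 𝓘(ℝ, E) q q, v)
        (0, K (extChartAt 𝓘(ℝ, E) q q) b)).comp (ContinuousLinearMap.inr ℝ E E))
      (fun c => by simpa using heq c)
    refine ⟨F, hF, fun (U : E × E) => ?_⟩
    rw [hFU, cartanTwoForm_eq hL]
    have h4 : ((0, 0) : E × E) = 0 := rfl
    simp [h4]
  exact congrArg Prod.snd h1

end Nonholonomic

/-! ### The curve condition as an infinitesimal relation -/

section Curves

variable {E : Type*} [NormedAddCommGroup E] [NormedSpace ℝ E] [CompleteSpace E]
  {Q : Type*} [TopologicalSpace Q] [ChartedSpace E Q] [IsManifold 𝓘(ℝ, E) ∞ Q]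

/-- For a second-order vector field `ξ` along the image of `X`, the Hamilton–Jacobi condition on
curves means that `X` and `ξ` are `X`-related. -/
lemma hjCurveCondition_iff
    {ξ : (w : TangentBundle 𝓘(ℝ, E) Q) → TangentSpace 𝓘(ℝ, E).tangent w}
    {X : (q : Q) → TangentSpace 𝓘(ℝ, E) q} (hX : IsSmoothField X)
    (hξ : ∀ q, tauDeriv ⟨q, X q⟩ (ξ ⟨q, X q⟩) = X q) :
    HJCurveCondition ξ X ↔ ∀ q, mfderiv 𝓘(ℝ, E) 𝓘(ℝ, E).tangent
      (fun q => (⟨q, X q⟩ : TangentBundle 𝓘(ℝ, E) Q)) q (X q) = ξ ⟨q, X q⟩ := by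
  have hd : ∀ q, MDifferentiableAt 𝓘(ℝ, E) 𝓘(ℝ, E).tangent
      (fun q => (⟨q, X q⟩ : TangentBundle 𝓘(ℝ, E) Q)) q := fun q =>
    (hX.mdifferentiable (by simp)).mdifferentiableAt
  have hξ' : (fun q => tauDeriv ⟨q, X q⟩ (ξ ⟨q, X q⟩)) = X := funext hξ
  rw [HJCurveCondition, hξ']
  constructor
  · intro h q
    -- An integral curve of `X` through `q` exists, and comparing the two derivatives of `X ∘ σ` at
    -- time `0` gives the relation at `q`. The converse is the chain rule.
    obtain ⟨σ, hσ0, hσ⟩ := exists_isMIntegralCurveAt_of_contMDiffAt_boundaryless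
      (I := 𝓘(ℝ, E)) (v := X) (x₀ := q) 0 (hX.contMDiffAt.of_le (by simp))
    obtain ⟨ε, hε, hσ⟩ := isMIntegralCurveAt_iff'.1 hσ
    have h1 := h _ Metric.isOpen_ball
      (by rw [Real.ball_eq_Ioo]; exact ordConnected_Ioo) σ hσ 0 (Metric.mem_ball_self hε)
    have h2 := h1.hasMFDerivAt (Metric.ball_mem_nhds _ hε)
    have h3 := (hσ 0 (Metric.mem_ball_self hε)).hasMFDerivAt (Metric.ball_mem_nhds _ hε)
    have h4 := hasMFDerivAt_unique (HasMFDerivAt.comp 0 (hd (σ 0)).hasMFDerivAt h3) h2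
    subst hσ0
    have h5 := congrArg (fun A : ℝ →L[ℝ] E × E => A 1) h4
    have h6 : ∀ (A : E →L[ℝ] E × E) (x : E) (y : E × E),
        (A.comp ((1 : ℝ →L[ℝ] ℝ).smulRight x)) (1 : ℝ) = ((1 : ℝ →L[ℝ] ℝ).smulRight y) (1 : ℝ) →
          A x = y := by
      intro A x y hxy
      simpa using hxy
    exact h6 _ _ _ h5
  · intro h s _ _ σ hσ t ht
    have h1 := HasMFDerivAt.comp_hasMFDerivWithinAt t (hd (σ t)).hasMFDerivAt (hσ t ht)
    have h2 : ∀ (A : E →L[ℝ] E × E) (x : E) (y : E × E), A x = y →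
        (A.comp ((1 : ℝ →L[ℝ] ℝ).smulRight x)) = ((1 : ℝ →L[ℝ] ℝ).smulRight y) := by
      rintro A x y rfl
      exact ContinuousLinearMap.ext_ring (by simp)
    have h3 := h2 _ _ _ (h (σ t))
    exact Eq.mp (congrArg (fun A => HasMFDerivWithinAt 𝓘(ℝ, ℝ) 𝓘(ℝ, E).tangent
      (fun t => (⟨σ t, X (σ t)⟩ : TangentBundle 𝓘(ℝ, E) Q)) s t A) h3) h1

end Curves

/-! ### Lie brackets and local extensions in a chart -/

section Brackets

variable {E : Type*} [NormedAddCommGroup E] [NormedSpace ℝ E]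
  {Q : Type*} [TopologicalSpace Q] [ChartedSpace E Q] [IsManifold 𝓘(ℝ, E) ∞ Q]

lemma mpullbackWithin_chart_symm {V : (q : Q) → TangentSpace 𝓘(ℝ, E) q} {q : Q} {V' : E → E}
    {x : E} (hx : x ∈ (extChartAt 𝓘(ℝ, E) q).target)
    (hV : V ((extChartAt 𝓘(ℝ, E) q).symm x) = chartFrame q x (V' x)) :
    VectorField.mpullbackWithin 𝓘(ℝ, E) 𝓘(ℝ, E) (extChartAt 𝓘(ℝ, E) q).symm V
      (range 𝓘(ℝ, E)) x = V' x := by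
  have h1 : (mfderivWithin 𝓘(ℝ, E) 𝓘(ℝ, E) (extChartAt 𝓘(ℝ, E) q).symm (range 𝓘(ℝ, E)) x) =
      mfderiv 𝓘(ℝ, E) 𝓘(ℝ, E) (extChartAt 𝓘(ℝ, E) q).symm x := by
    rw [modelWithCornersSelf_coe, range_id, mfderivWithin_univ]
  have h2 : (mfderiv 𝓘(ℝ, E) 𝓘(ℝ, E) (extChartAt 𝓘(ℝ, E) q).symm x).IsInvertible := by
    rw [← h1]; exact isInvertible_mfderivWithin_extChartAt_symm hx
  rw [VectorField.mpullbackWithin_apply, h1, hV]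
  obtain ⟨e, he⟩ := h2
  have h3 : chartFrame q x (V' x) = e (V' x) := by rw [chartFrame, ← he]; rfl
  rw [← he, ContinuousLinearMap.inverse_equiv, h3]
  exact e.symm_apply_apply _

/-- The Lie bracket in the chart centred at the point. -/
lemma mlieBracket_eq_of_chart {V W : (q : Q) → TangentSpace 𝓘(ℝ, E) q} {q : Q} {V' W' : E → E}
    (hV : ∀ᶠ x in 𝓝 (extChartAt 𝓘(ℝ, E) q q),
      V ((extChartAt 𝓘(ℝ, E) q).symm x) = chartFrame q x (V' x))
    (hW : ∀ᶠ x in 𝓝 (extChartAt 𝓘(ℝ, E) q q),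
      W ((extChartAt 𝓘(ℝ, E) q).symm x) = chartFrame q x (W' x)) :
    VectorField.mlieBracket 𝓘(ℝ, E) V W q =
      fderiv ℝ W' (extChartAt 𝓘(ℝ, E) q q) (V' (extChartAt 𝓘(ℝ, E) q q)) -
      fderiv ℝ V' (extChartAt 𝓘(ℝ, E) q q) (W' (extChartAt 𝓘(ℝ, E) q q)) := by
  have ht := extChartAt_target_mem_nhds (I := 𝓘(ℝ, E)) q
  have hV' : VectorField.mpullbackWithin 𝓘(ℝ, E) 𝓘(ℝ, E) (extChartAt 𝓘(ℝ, E) q).symm V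
      (range 𝓘(ℝ, E)) =ᶠ[𝓝 (extChartAt 𝓘(ℝ, E) q q)] V' := by
    filter_upwards [ht, hV] with x hx h using mpullbackWithin_chart_symm hx h
  have hW' : VectorField.mpullbackWithin 𝓘(ℝ, E) 𝓘(ℝ, E) (extChartAt 𝓘(ℝ, E) q).symm W
      (range 𝓘(ℝ, E)) =ᶠ[𝓝 (extChartAt 𝓘(ℝ, E) q q)] W' := by
    filter_upwards [ht, hW] with x hx h using mpullbackWithin_chart_symm hx h
  have h1 : ∀ X : E, (mfderiv 𝓘(ℝ, E) 𝓘(ℝ, E) (extChartAt 𝓘(ℝ, E) q) q).inverse X = X := by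
    intro X
    have key : ∀ A : E →L[ℝ] E, A = ContinuousLinearMap.id ℝ E → A.inverse X = X := by
      rintro _ rfl
      rw [ContinuousLinearMap.inverse_id]; rfl
    exact key _ mfderiv_extChartAt_self
  have h2 : ∀ (F G : E → E) (s : Set E), F =ᶠ[𝓝 (extChartAt 𝓘(ℝ, E) q q)] V' →
      G =ᶠ[𝓝 (extChartAt 𝓘(ℝ, E) q q)] W' → s = univ →
      VectorField.lieBracketWithin ℝ F G s (extChartAt 𝓘(ℝ, E) q q) =
        fderiv ℝ W' (extChartAt 𝓘(ℝ, E) q q) (V' (extChartAt 𝓘(ℝ, E) q q)) -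
        fderiv ℝ V' (extChartAt 𝓘(ℝ, E) q q) (W' (extChartAt 𝓘(ℝ, E) q q)) := by
    rintro F G _ hF hG rfl
    rw [VectorField.lieBracketWithin_univ, hF.lieBracket_vectorField_eq hG,
      VectorField.lieBracket_eq]
  refine (h1 _).trans (h2 _ _ _ hV' hW' ?_)
  rw [modelWithCornersSelf_coe, preimage_univ, range_id, inter_univ]

/-- The extension used to define the curvature on vectors is the field with constant coefficients in
the chart at `q`, so its own derivatives drop out of the brackets. -/
lemma extend_chart_symm (q : Q) (u : E) {x : E} (hx : x ∈ (extChartAt 𝓘(ℝ, E) q).target) :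
    FiberBundle.extend E (E := TangentSpace 𝓘(ℝ, E)) (x := q) u
      ((extChartAt 𝓘(ℝ, E) q).symm x) = chartFrame q x u := by
  have hs := (extChartAt 𝓘(ℝ, E) q).map_target hx
  rw [extChartAt_source] at hs
  have h1 := TangentBundle.symmL_trivializationAt (I := 𝓘(ℝ, E)) hs
  rw [modelWithCornersSelf_coe, range_id, mfderivWithin_univ,
    (extChartAt 𝓘(ℝ, E) q).right_inv hx] at h1
  have h2 : (trivializationAt E (TangentSpace 𝓘(ℝ, E)) q ⟨q, u⟩).2 = u := by
    have := extChartAt_tangent_self q u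
    exact congrArg Prod.snd this
  have h3 := congrArg (fun A : E →L[ℝ] E => A u) h1
  refine Eq.trans ?_ h3
  change (trivializationAt E (TangentSpace 𝓘(ℝ, E)) q).symm ((extChartAt 𝓘(ℝ, E) q).symm x)
    (trivializationAt E (TangentSpace 𝓘(ℝ, E)) q ⟨q, u⟩).2 = _
  rw [h2]
  exact (Trivialization.symmL_apply (R := ℝ) (trivializationAt E (TangentSpace 𝓘(ℝ, E)) q) hs u).symm

end Brackets

/-! ### The projection, the horizontal lift and the horizontal projector in coordinates -/

section Connection

variable {E : Type*} [NormedAddCommGroup E] [NormedSpace ℝ E]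
  {E' : Type*} [NormedAddCommGroup E'] [NormedSpace ℝ E']
  {Q : Type*} [TopologicalSpace Q] [ChartedSpace E Q]
  {N : Type*} [TopologicalSpace N] [ChartedSpace E' N]

/-- The projection `ρ` in the charts at `q` and `ρ q`. -/
noncomputable def projRep (E E' : Type*) [NormedAddCommGroup E] [NormedSpace ℝ E]
    [NormedAddCommGroup E'] [NormedSpace ℝ E'] [ChartedSpace E Q] [ChartedSpace E' N]
    (ρ : Q → N) (q : Q) (x : E) : E' :=
  extChartAt 𝓘(ℝ, E') (ρ q) (ρ ((extChartAt 𝓘(ℝ, E) q).symm x))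

/-- The neighbourhood of the centre of the chart at `q` on which `ρ` is expressed in coordinates. -/
def projRepDomain (E E' : Type*) [NormedAddCommGroup E] [NormedSpace ℝ E]
    [NormedAddCommGroup E'] [NormedSpace ℝ E'] [ChartedSpace E Q] [ChartedSpace E' N]
    (ρ : Q → N) (q : Q) : Set E :=
  {x | x ∈ (extChartAt 𝓘(ℝ, E) q).target ∧
    ρ ((extChartAt 𝓘(ℝ, E) q).symm x) ∈ (extChartAt 𝓘(ℝ, E') (ρ q)).source}

variable {ρ : Q → N}

/-- The derivative of `ρ`, read in the model spaces. -/
noncomputable def projDeriv (E E' : Type*) [NormedAddCommGroup E] [NormedSpace ℝ E]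
    [NormedAddCommGroup E'] [NormedSpace ℝ E'] [ChartedSpace E Q] [ChartedSpace E' N]
    (ρ : Q → N) (q : Q) : E →L[ℝ] E' :=
  mfderiv 𝓘(ℝ, E) 𝓘(ℝ, E') ρ q

lemma projRep_self (q : Q) :
    projRep E E' ρ q (extChartAt 𝓘(ℝ, E) q q) = extChartAt 𝓘(ℝ, E') (ρ q) (ρ q) := by
  rw [projRep, extChartAt_to_inv]

lemma hasMFDerivAt_proj (hρ : ContMDiff 𝓘(ℝ, E) 𝓘(ℝ, E') ∞ ρ) (q : Q) :
    HasMFDerivAt 𝓘(ℝ, E) 𝓘(ℝ, E') ρ q (projDeriv E E' ρ q) :=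
  ((hρ.mdifferentiable (by simp)).mdifferentiableAt).hasMFDerivAt

lemma projRepDomain_mem_nhds (hρ : ContMDiff 𝓘(ℝ, E) 𝓘(ℝ, E') ∞ ρ) (q : Q) :
    projRepDomain E E' ρ q ∈ 𝓝 (extChartAt 𝓘(ℝ, E) q q) := by
  have h1 : ContinuousAt (fun x => ρ ((extChartAt 𝓘(ℝ, E) q).symm x))
      (extChartAt 𝓘(ℝ, E) q q) :=
    ContinuousAt.comp (g := ρ) hρ.continuous.continuousAt (continuousAt_extChartAt_symm q)
  have h2 : (extChartAt 𝓘(ℝ, E') (ρ q)).source ∈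
      𝓝 (ρ ((extChartAt 𝓘(ℝ, E) q).symm (extChartAt 𝓘(ℝ, E) q q))) := by
    rw [extChartAt_to_inv]
    exact extChartAt_source_mem_nhds (ρ q)
  exact inter_mem (extChartAt_target_mem_nhds q) (h1 h2)

variable [IsManifold 𝓘(ℝ, E) ∞ Q] [IsManifold 𝓘(ℝ, E') ∞ N]

lemma contDiffAt_projRep (hρ : ContMDiff 𝓘(ℝ, E) 𝓘(ℝ, E') ∞ ρ) (q : Q) {x : E}
    (hx : x ∈ projRepDomain E E' ρ q) : ContDiffAt ℝ ∞ (projRep E E' ρ q) x := by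
  have h1 : ContMDiffAt 𝓘(ℝ, E) 𝓘(ℝ, E) ∞ (extChartAt 𝓘(ℝ, E) q).symm x :=
    (contMDiffOn_extChartAt_symm q).contMDiffAt ((isOpen_extChartAt_target q).mem_nhds hx.1)
  have h2 : ContMDiffAt 𝓘(ℝ, E') 𝓘(ℝ, E') ∞ (extChartAt 𝓘(ℝ, E') (ρ q))
      (ρ ((extChartAt 𝓘(ℝ, E) q).symm x)) :=
    contMDiffAt_extChartAt' (by simpa using hx.2)
  exact (h2.comp x (hρ.contMDiffAt.comp x h1)).contDiffAt

/-- `Tρ` in coordinates. -/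
lemma projDeriv_chartFrame (hρ : ContMDiff 𝓘(ℝ, E) 𝓘(ℝ, E') ∞ ρ) (q : Q) {x : E}
    (hx : x ∈ projRepDomain E E' ρ q) (a : E) :
    projDeriv E E' ρ ((extChartAt 𝓘(ℝ, E) q).symm x) (chartFrame q x a) =
      chartFrame (ρ q) (projRep E E' ρ q x) (fderiv ℝ (projRep E E' ρ q) x a) := by
  have ht : projRep E E' ρ q x ∈ (extChartAt 𝓘(ℝ, E') (ρ q)).target :=
    (extChartAt 𝓘(ℝ, E') (ρ q)).map_source hx.2
  have h1 := HasMFDerivAt.comp x (hasMFDerivAt_chart_symm (ρ q) ht)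
    ((contDiffAt_projRep hρ q hx).differentiableAt (by simp)).hasFDerivAt.hasMFDerivAt
  have h2 : ContinuousAt (fun x => ρ ((extChartAt 𝓘(ℝ, E) q).symm x)) x :=
    ContinuousAt.comp (g := ρ) hρ.continuous.continuousAt
      (continuousAt_extChartAt_symm'' hx.1)
  exact HasMFDerivAt.comp_apply_eq (hasMFDerivAt_proj hρ _) (hasMFDerivAt_chart_symm q hx.1) rfl
    h1 ((h2.eventually ((isOpen_extChartAt_source (ρ q)).mem_nhds hx.2)).mono fun z hz =>
      ((extChartAt 𝓘(ℝ, E') (ρ q)).left_inv hz).symm) a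

namespace EhresmannConnection

variable (Γ : EhresmannConnection E E' ρ)

/-- The horizontal lift, read in the model spaces. -/
noncomputable def liftModel (q : Q) : E' →L[ℝ] E := Γ.lift q

/-- The horizontal lift in the charts at `q` and `ρ q`. -/
noncomputable def liftRep (q : Q) (x : E) : E' →L[ℝ] E :=
  (chartCoframe q ((extChartAt 𝓘(ℝ, E) q).symm x)).comp
    ((Γ.liftModel ((extChartAt 𝓘(ℝ, E) q).symm x)).comp
      (chartFrame (ρ q) (projRep E E' ρ q x)))

lemma liftRep_self (q : Q) : Γ.liftRep q (extChartAt 𝓘(ℝ, E) q q) = Γ.liftModel q := by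
  rw [liftRep, extChartAt_to_inv, chartCoframe_self, projRep_self, chartFrame_self]
  rfl

/-- The horizontal lift in coordinates. -/
lemma liftModel_chartFrame (q : Q) {x : E} (hx : x ∈ projRepDomain E E' ρ q) (c : E') :
    Γ.liftModel ((extChartAt 𝓘(ℝ, E) q).symm x) (chartFrame (ρ q) (projRep E E' ρ q x) c) =
      chartFrame q x (Γ.liftRep q x c) := by
  have := chartFrame_chartCoframe q ((extChartAt 𝓘(ℝ, E) q).map_target hx.1)
    (Γ.liftModel ((extChartAt 𝓘(ℝ, E) q).symm x) (chartFrame (ρ q) (projRep E E' ρ q x) c))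
  rw [(extChartAt 𝓘(ℝ, E) q).right_inv hx.1] at this
  exact this.symm

lemma projDeriv_liftModel (q : Q) (c : E') : projDeriv E E' ρ q (Γ.liftModel q c) = c :=
  Γ.mfderiv_lift q c

/-- The splitting identity is stated on a neighbourhood, not only at the centre, because its
derivative is needed to compute the curvature. -/
lemma fderiv_projRep_liftRep (hρ : ContMDiff 𝓘(ℝ, E) 𝓘(ℝ, E') ∞ ρ) (q : Q) {x : E}
    (hx : x ∈ projRepDomain E E' ρ q) (c : E') :
    fderiv ℝ (projRep E E' ρ q) x (Γ.liftRep q x c) = c := by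
  have h1 := projDeriv_chartFrame hρ q hx (Γ.liftRep q x c)
  rw [← Γ.liftModel_chartFrame q hx, projDeriv_liftModel] at h1
  have ht : projRep E E' ρ q x ∈ (extChartAt 𝓘(ℝ, E') (ρ q)).target :=
    (extChartAt 𝓘(ℝ, E') (ρ q)).map_source hx.2
  have h2 := congrArg (chartCoframe (ρ q) ((extChartAt 𝓘(ℝ, E') (ρ q)).symm
    (projRep E E' ρ q x))) h1
  rw [chartCoframe_chartFrame _ ht, chartCoframe_chartFrame _ ht] at h2
  exact h2.symm

lemma contDiffAt_liftRep (hρ : ContMDiff 𝓘(ℝ, E) 𝓘(ℝ, E') ∞ ρ) (q : Q) :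
    ContDiffAt ℝ ∞ (Γ.liftRep q) (extChartAt 𝓘(ℝ, E) q q) := by
  have h1 : ContMDiffAt 𝓘(ℝ, E) 𝓘(ℝ, E) ∞ (extChartAt 𝓘(ℝ, E) q).symm
      (extChartAt 𝓘(ℝ, E) q q) :=
    (contMDiffOn_extChartAt_symm q).contMDiffAt (extChartAt_target_mem_nhds q)
  have h2 := Γ.smooth q
  rw [← extChartAt_to_inv (I := 𝓘(ℝ, E)) q] at h2
  have h3 := h2.comp (extChartAt 𝓘(ℝ, E) q q) h1
  rw [extChartAt_to_inv] at h3
  refine (h3.contDiffAt).congr_of_eventuallyEq ?_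
  filter_upwards [projRepDomain_mem_nhds hρ q] with x hx
  rw [comp_apply, inTangentCoordinates_eq_mfderiv_comp (by simpa using hx.2)
    (by simpa using (extChartAt 𝓘(ℝ, E) q).map_target hx.1)]
  have h4 : mfderivWithin 𝓘(ℝ, E') 𝓘(ℝ, E') (extChartAt 𝓘(ℝ, E') (ρ q)).symm
      (range 𝓘(ℝ, E')) (extChartAt 𝓘(ℝ, E') (ρ q) (ρ ((extChartAt 𝓘(ℝ, E) q).symm x))) =
      mfderiv 𝓘(ℝ, E') 𝓘(ℝ, E') (extChartAt 𝓘(ℝ, E') (ρ q)).symm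
        (extChartAt 𝓘(ℝ, E') (ρ q) (ρ ((extChartAt 𝓘(ℝ, E) q).symm x))) := by
    rw [modelWithCornersSelf_coe, range_id, mfderivWithin_univ]
  rw [h4]
  rfl

/-- The horizontal projector in the chart at `q`. -/
noncomputable def horRep (q : Q) (x : E) : E →L[ℝ] E :=
  (Γ.liftRep q x).comp (fderiv ℝ (projRep E E' ρ q) x)

lemma hor_chartFrame (hρ : ContMDiff 𝓘(ℝ, E) 𝓘(ℝ, E') ∞ ρ) (q : Q) {x : E}
    (hx : x ∈ projRepDomain E E' ρ q) (a : E) :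
    Γ.hor ((extChartAt 𝓘(ℝ, E) q).symm x) (chartFrame q x a) =
      chartFrame q x (Γ.horRep q x a) := by
  rw [horRep, ContinuousLinearMap.comp_apply, ← Γ.liftModel_chartFrame q hx,
    ← projDeriv_chartFrame hρ q hx]
  rfl

lemma projMap_hor_chartPoint (hρ : ContMDiff 𝓘(ℝ, E) 𝓘(ℝ, E') ∞ ρ) (q : Q) {x : E}
    (hx : x ∈ projRepDomain E E' ρ q) (v : E) :
    projMap Γ.hor (chartPoint q (x, v)) = chartPoint q (x, Γ.horRep q x v) := by
  have := Γ.hor_chartFrame hρ q hx v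
  exact congrArg (fun u : E => (⟨(extChartAt 𝓘(ℝ, E) q).symm x, u⟩ : TangentBundle 𝓘(ℝ, E) Q)) this

end EhresmannConnection

end Connection

/-- As points of the total space, a vector and its transport along an equality of base points
coincide; this disposes of the casts in `liftAt`. -/
lemma mk_cast_eq {E' : Type*} [NormedAddCommGroup E'] [NormedSpace ℝ E']
    {N : Type*} [TopologicalSpace N] [ChartedSpace E' N] {y y' : N} (h : y' = y)
    (v : TangentSpace 𝓘(ℝ, E') y) :
    (⟨y', h.symm ▸ v⟩ : TangentBundle 𝓘(ℝ, E') N) = ⟨y, v⟩ := by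
  subst h; rfl

/-! ### The curvature and the reduced data in coordinates -/

section Caplygin

variable {E : Type*} [NormedAddCommGroup E] [NormedSpace ℝ E]
  {E' : Type*} [NormedAddCommGroup E'] [NormedSpace ℝ E']
  {Q : Type*} [TopologicalSpace Q] [ChartedSpace E Q] [IsManifold 𝓘(ℝ, E) ∞ Q]
  {N : Type*} [TopologicalSpace N] [ChartedSpace E' N] [IsManifold 𝓘(ℝ, E') ∞ N] {ρ : Q → N}

namespace EhresmannConnection

variable (Γ : EhresmannConnection E E' ρ)

/-- The derivative of `liftRep` at the centre of the chart. -/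
noncomputable def liftRepDeriv (q : Q) : E →L[ℝ] E' →L[ℝ] E :=
  fderiv ℝ (Γ.liftRep q) (extChartAt 𝓘(ℝ, E) q q)

lemma hasFDerivAt_liftRep (hρ : ContMDiff 𝓘(ℝ, E) 𝓘(ℝ, E') ∞ ρ) (q : Q) :
    HasFDerivAt (Γ.liftRep q) (Γ.liftRepDeriv q) (extChartAt 𝓘(ℝ, E) q q) :=
  ((Γ.contDiffAt_liftRep hρ q).differentiableAt (by simp)).hasFDerivAt

lemma hasFDerivAt_fderiv_projRep (hρ : ContMDiff 𝓘(ℝ, E) 𝓘(ℝ, E') ∞ ρ) (q : Q) :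
    HasFDerivAt (fderiv ℝ (projRep E E' ρ q))
      (fderiv ℝ (fderiv ℝ (projRep E E' ρ q)) (extChartAt 𝓘(ℝ, E) q q))
      (extChartAt 𝓘(ℝ, E) q q) :=
  (((contDiffAt_projRep hρ q (mem_of_mem_nhds (projRepDomain_mem_nhds hρ q))).fderiv_right (m := 1)
    (by norm_cast)).differentiableAt (by simp)).hasFDerivAt

lemma fderiv_projRep_liftModel (hρ : ContMDiff 𝓘(ℝ, E) 𝓘(ℝ, E') ∞ ρ) (q : Q) (c : E') :
    fderiv ℝ (projRep E E' ρ q) (extChartAt 𝓘(ℝ, E) q q) (Γ.liftModel q c) = c := by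
  rw [← Γ.liftRep_self]
  exact Γ.fderiv_projRep_liftRep hρ q (mem_of_mem_nhds (projRepDomain_mem_nhds hρ q)) c

lemma horRep_self_liftModel (hρ : ContMDiff 𝓘(ℝ, E) 𝓘(ℝ, E') ∞ ρ) (q : Q) (c : E') :
    Γ.horRep q (extChartAt 𝓘(ℝ, E) q q) (Γ.liftModel q c) = Γ.liftModel q c := by
  rw [horRep, ContinuousLinearMap.comp_apply, Γ.fderiv_projRep_liftModel hρ, Γ.liftRep_self]

/-- The product rule for `K = ℓ ∘ Dr`. On horizontal vectors `Dr (ℓ c) = c`, which simplifies the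
term in `Dℓ`. -/
lemma exists_hasFDerivAt_horRep (hρ : ContMDiff 𝓘(ℝ, E) 𝓘(ℝ, E') ∞ ρ) (q : Q) :
    ∃ K' : E →L[ℝ] E →L[ℝ] E, HasFDerivAt (Γ.horRep q) K' (extChartAt 𝓘(ℝ, E) q q) ∧
      ∀ (a : E) (c : E'), K' a (Γ.liftModel q c) = Γ.liftRepDeriv q a c + Γ.liftModel q
        (fderiv ℝ (fderiv ℝ (projRep E E' ρ q)) (extChartAt 𝓘(ℝ, E) q q) a (Γ.liftModel q c)) := by
  refine ⟨_, (Γ.hasFDerivAt_liftRep hρ q).clm_comp (hasFDerivAt_fderiv_projRep hρ q),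
    fun a c => ?_⟩
  simp only [add_apply, ContinuousLinearMap.comp_apply, ContinuousLinearMap.flip_apply,
    ContinuousLinearMap.compL_apply, Γ.liftRep_self]
  rw [Γ.fderiv_projRep_liftModel hρ, add_comm]

/-- The derivative of the identity `Tρ ∘ lift = id`. -/
lemma fderiv_projRep_liftRepDeriv (hρ : ContMDiff 𝓘(ℝ, E) 𝓘(ℝ, E') ∞ ρ) (q : Q) (a : E) (c : E') :
    fderiv ℝ (projRep E E' ρ q) (extChartAt 𝓘(ℝ, E) q q) (Γ.liftRepDeriv q a c) =
      -fderiv ℝ (fderiv ℝ (projRep E E' ρ q)) (extChartAt 𝓘(ℝ, E) q q) a (Γ.liftModel q c) := by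
  have h1 := (hasFDerivAt_fderiv_projRep hρ q).clm_apply
    ((Γ.hasFDerivAt_liftRep hρ q).clm_apply (hasFDerivAt_const c _))
  have h2 : HasFDerivAt (fun x => fderiv ℝ (projRep E E' ρ q) x (Γ.liftRep q x c))
      (0 : E →L[ℝ] E') (extChartAt 𝓘(ℝ, E) q q) := by
    refine (hasFDerivAt_const c _).congr_of_eventuallyEq ?_
    filter_upwards [projRepDomain_mem_nhds hρ q] with x hx
    exact Γ.fderiv_projRep_liftRep hρ q hx c
  have h3 := congrArg (fun A : E →L[ℝ] E' => A a) (h1.unique h2)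
  rw [← Γ.liftRep_self]
  simp at h3
  simpa using eq_neg_of_add_eq_zero_left h3

/-- The curvature in coordinates. -/
lemma curvature_liftModel (hρ : ContMDiff 𝓘(ℝ, E) 𝓘(ℝ, E') ∞ ρ) (q : Q) (ξ η : E') :
    Γ.curvature q (Γ.liftModel q ξ) (Γ.liftModel q η) =
      Γ.liftRepDeriv q (Γ.liftModel q ξ) η - Γ.liftRepDeriv q (Γ.liftModel q η) ξ := by
  obtain ⟨K', hK, hK'⟩ := Γ.exists_hasFDerivAt_horRep hρ q
  set x₀ := extChartAt 𝓘(ℝ, E) q q with hx₀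
  have hext : ∀ u : E, ∀ᶠ x in 𝓝 x₀, FiberBundle.extend E (E := TangentSpace 𝓘(ℝ, E)) (x := q) u
      ((extChartAt 𝓘(ℝ, E) q).symm x) = chartFrame q x ((fun _ => u) x) := fun u => by
    filter_upwards [extChartAt_target_mem_nhds q] with x hx using extend_chart_symm q u hx
  have hhor : ∀ u : E, ∀ᶠ x in 𝓝 x₀,
      Γ.horField (FiberBundle.extend E (E := TangentSpace 𝓘(ℝ, E)) (x := q) u)
      ((extChartAt 𝓘(ℝ, E) q).symm x) = chartFrame q x ((fun x => Γ.horRep q x u) x) := fun u => by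
    filter_upwards [projRepDomain_mem_nhds hρ q] with x hx
    refine Eq.trans ?_ (Γ.hor_chartFrame hρ q hx u)
    rw [← extend_chart_symm q u hx.1]; rfl
  have hd : ∀ u a : E, fderiv ℝ (fun x => Γ.horRep q x u) x₀ a = K' a u := fun u a => by
    rw [(hK.clm_apply (hasFDerivAt_const u _)).fderiv]; simp
  let h₀ : E →L[ℝ] E := Γ.hor q
  have hself : ∀ a : E, h₀ a = Γ.liftModel q (fderiv ℝ (projRep E E' ρ q) x₀ a) := fun a => by
    have := Γ.hor_chartFrame hρ q (mem_of_mem_nhds (projRepDomain_mem_nhds hρ q)) a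
    rw [chartFrame_self, horRep, Γ.liftRep_self, extChartAt_to_inv] at this
    exact this
  have hsymm : ∀ a b, fderiv ℝ (fderiv ℝ (projRep E E' ρ q)) x₀ a b =
      fderiv ℝ (fderiv ℝ (projRep E E' ρ q)) x₀ b a := fun a b =>
    (contDiffAt_projRep hρ q (mem_of_mem_nhds (projRepDomain_mem_nhds hρ q))).isSymmSndFDerivAt
      (by simpa using ENat.LEInfty.out) a b
  have b1 := mlieBracket_eq_of_chart (hhor (Γ.liftModel q ξ)) (hhor (Γ.liftModel q η))
  have b2 := mlieBracket_eq_of_chart (hhor (Γ.liftModel q ξ)) (hext (Γ.liftModel q η))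
  have b3 := mlieBracket_eq_of_chart (hext (Γ.liftModel q ξ)) (hhor (Γ.liftModel q η))
  have b4 := mlieBracket_eq_of_chart (hext (Γ.liftModel q ξ)) (hext (Γ.liftModel q η))
  rw [← hx₀, hd, hd, Γ.horRep_self_liftModel hρ, Γ.horRep_self_liftModel hρ] at b1
  rw [← hx₀, hd, fderiv_fun_const] at b2
  rw [← hx₀, hd, fderiv_fun_const] at b3
  rw [fderiv_fun_const, fderiv_fun_const] at b4
  -- By the derivative of `Dr ∘ ℓ = id`, the vector `K' a (ℓ c)` is vertical, so `h` kills both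
  -- mixed brackets. In `[hX, hY]` the terms with `D²r` cancel by symmetry.
  have key : ∀ B1 B2 B3 B4 : E,
      B1 = K' (Γ.liftModel q ξ) (Γ.liftModel q η) - K' (Γ.liftModel q η) (Γ.liftModel q ξ) →
      B2 = 0 - K' (Γ.liftModel q η) (Γ.liftModel q ξ) →
      B3 = K' (Γ.liftModel q ξ) (Γ.liftModel q η) - 0 → B4 = 0 →
      B1 - h₀ B2 - h₀ B3 + h₀ (h₀ B4) =
        Γ.liftRepDeriv q (Γ.liftModel q ξ) η - Γ.liftRepDeriv q (Γ.liftModel q η) ξ := by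
    rintro _ _ _ _ rfl rfl rfl rfl
    have c1 : ∀ c, fderiv ℝ (projRep E E' ρ q) x₀ (Γ.liftModel q c) = c :=
      Γ.fderiv_projRep_liftModel hρ q
    have c2 : ∀ a c, fderiv ℝ (projRep E E' ρ q) x₀ (Γ.liftRepDeriv q a c) =
        -fderiv ℝ (fderiv ℝ (projRep E E' ρ q)) x₀ a (Γ.liftModel q c) :=
      Γ.fderiv_projRep_liftRepDeriv hρ q
    rw [hself, hself, hself, hself]
    simp only [hK', hsymm (Γ.liftModel q η) (Γ.liftModel q ξ), map_add, map_sub, map_zero, c1, c2,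
      map_neg]
    abel
  exact key _ _ _ _ b1 b2 b3 (b4.trans (sub_zero _))

lemma liftModel_mem_constraintSet (q : Q) (c : E') :
    (⟨q, Γ.liftModel q c⟩ : TangentBundle 𝓘(ℝ, E) Q) ∈ constraintSet Γ.hor := by
  refine ⟨Γ.liftModel q c, ?_⟩
  change Γ.liftModel q (projDeriv E E' ρ q (Γ.liftModel q c)) = _
  rw [projDeriv_liftModel]

variable {L : TangentBundle 𝓘(ℝ, E) Q → ℝ}

/-- Invariance replaces the point chosen by `surjInv` with any point of the fibre, in particular the
centre of the chart in use. -/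
lemma reducedLagrangian_eq (hsurj : Surjective ρ) (hinv : Γ.IsInvariant L) (q : Q) (u : E') :
    Γ.reducedLagrangian hsurj L ⟨ρ q, u⟩ = L ⟨q, Γ.liftModel q u⟩ := by
  refine hinv _ (Γ.liftModel_mem_constraintSet _ _) _ (Γ.liftModel_mem_constraintSet _ _) ?_
  have h1 : ∀ (q : Q) (c : TangentSpace 𝓘(ℝ, E') (ρ q)), tangentMap 𝓘(ℝ, E) 𝓘(ℝ, E') ρ
      (⟨q, Γ.lift q c⟩ : TangentBundle 𝓘(ℝ, E) Q) = ⟨ρ q, c⟩ := fun q c => by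
    rw [tangentMap, Γ.mfderiv_lift]
  exact (h1 _ _).trans ((mk_cast_eq (surjInv_eq hsurj (ρ q)) u).trans (h1 q u).symm)

lemma reducedForce_eq (hsurj : Surjective ρ) (hforce : Γ.ForceWellDefined L) (q : Q) (u : E')
    (U : E' × E') :
    Γ.reducedForce hsurj L ⟨ρ q, u⟩ U = -legendre L ⟨q, Γ.liftModel q u⟩
      (Γ.curvature q (Γ.liftModel q u) (Γ.liftModel q U.1)) := by
  refine congrArg Neg.neg (hforce _ q _ _ u U.1 (mk_cast_eq (surjInv_eq hsurj (ρ q)) u) ?_)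
  rw [← tauDeriv_mk (ρ q) u U]
  exact mk_cast_eq (surjInv_eq hsurj (ρ q)) _

/-- The defining relation of the reduced lagrangian, in coordinates. -/
lemma localRep_reducedLagrangian (hsurj : Surjective ρ) (hinv : Γ.IsInvariant L) (q : Q) {x : E}
    (hx : x ∈ projRepDomain E E' ρ q) (c : E') :
    localRep (Γ.reducedLagrangian hsurj L) (ρ q) (projRep E E' ρ q x, c) =
      localRep L q (x, Γ.liftRep q x c) := by
  have h1 : chartPoint (ρ q) (projRep E E' ρ q x, c) =
      (⟨ρ ((extChartAt 𝓘(ℝ, E) q).symm x), chartFrame (ρ q) (projRep E E' ρ q x) c⟩ :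
        TangentBundle 𝓘(ℝ, E') N) := by
    have h2 := (extChartAt 𝓘(ℝ, E') (ρ q)).left_inv hx.2
    exact congrArg (fun y : N =>
      (⟨y, chartFrame (ρ q) (projRep E E' ρ q x) c⟩ : TangentBundle 𝓘(ℝ, E') N)) h2
  rw [localRep, h1, Γ.reducedLagrangian_eq hsurj hinv, Γ.liftModel_chartFrame q hx]
  rfl

end EhresmannConnection

/-- A submersion with a splitting of its derivative at a point has a local section through that
point. -/
lemma exists_local_section {F F' : Type*} [NormedAddCommGroup F] [NormedSpace ℝ F]
    [NormedAddCommGroup F'] [NormedSpace ℝ F'] [CompleteSpace F'] {r : F → F'} {x : F}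
    (hr : ContDiffAt ℝ ∞ r x) (A : F' →L[ℝ] F) (hA : ∀ c, fderiv ℝ r x (A c) = c) :
    ∃ s : F' → F, ContDiffAt ℝ ∞ s (r x) ∧ s (r x) = x ∧ ∀ᶠ y in 𝓝 (r x), r (s y) = y := by
  -- The affine map along the splitting satisfies `D(r ∘ g) = id` at `r x`. The inverse function
  -- theorem inverts `r ∘ g`, and `g` after this inverse is the section.
  let g : F' → F := fun y => x + A (y - r x)
  have hg0 : g (r x) = x := by simp [g]
  have hg : ContDiff ℝ ∞ g := contDiff_const.add (A.contDiff.comp (contDiff_id.sub contDiff_const))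
  have hgd : HasFDerivAt g A (r x) := by
    have h1 := (A.hasFDerivAt.comp (r x) ((hasFDerivAt_id (r x)).sub_const (r x))).const_add x
    rw [ContinuousLinearMap.comp_id] at h1
    exact h1
  have hr' : ContDiffAt ℝ ∞ r (g (r x)) := by rwa [hg0]
  have hf : ContDiffAt ℝ ∞ (r ∘ g) (r x) := hr'.comp (r x) hg.contDiffAt
  have hfd : HasFDerivAt (r ∘ g) ((ContinuousLinearEquiv.refl ℝ F' : F' ≃L[ℝ] F') : F' →L[ℝ] F')
      (r x) := by
    have h1 := (hr'.differentiableAt (by simp)).hasFDerivAt.comp (r x) hgd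
    convert h1 using 1
    ext c
    rw [hg0]
    simp [hA]
  have hn : (∞ : WithTop ℕ∞) ≠ 0 := by simp
  have hfs := hf.hasStrictFDerivAt' hfd hn
  have hfx : (r ∘ g) (r x) = r x := by rw [comp_apply, hg0]
  refine ⟨g ∘ hfs.localInverse (r ∘ g) _ (r x), ?_, ?_, ?_⟩
  · have h1 := hf.to_localInverse hfd hn
    rw [hfx] at h1
    exact hg.contDiffAt.comp (r x) h1
  · have h1 := hfs.localInverse_apply_image
    rw [hfx] at h1
    rw [comp_apply, h1, hg0]
  · have h1 := hfs.eventually_right_inverse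
    rw [hfx] at h1
    exact h1

end Caplygin

/-! ### Smoothness and derivatives of the reduced lagrangian -/

section Caplygin

variable {E : Type*} [NormedAddCommGroup E] [NormedSpace ℝ E]
  {E' : Type*} [NormedAddCommGroup E'] [NormedSpace ℝ E']
  {Q : Type*} [TopologicalSpace Q] [ChartedSpace E Q] [IsManifold 𝓘(ℝ, E) ∞ Q]
  {N : Type*} [TopologicalSpace N] [ChartedSpace E' N] [IsManifold 𝓘(ℝ, E') ∞ N] {ρ : Q → N}

namespace EhresmannConnection

variable (Γ : EhresmannConnection E E' ρ) {L : TangentBundle 𝓘(ℝ, E) Q → ℝ}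

/-- The points chosen by `surjInv` need not vary continuously. A smooth local section `s` of the
submersion gives instead the smooth local formula `L^*(y, v) = L(s y, ℓ(s y) v)`. -/
lemma contMDiff_reducedLagrangian [CompleteSpace E'] (hρ : ContMDiff 𝓘(ℝ, E) 𝓘(ℝ, E') ∞ ρ)
    (hsurj : Surjective ρ) (hL : ContMDiff 𝓘(ℝ, E).tangent 𝓘(ℝ, ℝ) ∞ L)
    (hinv : Γ.IsInvariant L) :
    ContMDiff 𝓘(ℝ, E').tangent 𝓘(ℝ, ℝ) ∞ (Γ.reducedLagrangian hsurj L) := by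
  refine contMDiff_of_localRep fun y v => ?_
  obtain ⟨q, rfl⟩ := hsurj y
  have hdom := projRepDomain_mem_nhds hρ q
  obtain ⟨s, hs, hs0, hsr⟩ := exists_local_section (contDiffAt_projRep hρ q (mem_of_mem_nhds hdom))
    (Γ.liftModel q) (Γ.fderiv_projRep_liftModel hρ q)
  rw [projRep_self] at hs hs0 hsr
  set y₀ := extChartAt 𝓘(ℝ, E') (ρ q) (ρ q)
  have h1 : ContDiffAt ℝ ∞ (fun z : E' × E' => s z.1) (y₀, v) :=
    ContDiffAt.comp (g := s) (y₀, v) hs contDiffAt_fst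
  have hl : ContDiffAt ℝ ∞ (Γ.liftRep q) (s y₀) := by
    rw [hs0]; exact Γ.contDiffAt_liftRep hρ q
  have h2 : ContDiffAt ℝ ∞ (fun z : E' × E' => Γ.liftRep q (s z.1)) (y₀, v) :=
    ContDiffAt.comp (g := Γ.liftRep q) (y₀, v) hl h1
  have h3 : ContDiffAt ℝ ∞ (fun z : E' × E' => (s z.1, Γ.liftRep q (s z.1) z.2)) (y₀, v) :=
    h1.prodMk (h2.clm_apply contDiffAt_snd)
  have h4 : ContDiffAt ℝ ∞ (localRep L q) (s y₀, Γ.liftRep q (s y₀) v) :=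
    contDiffAt_localRep hL q (by rw [hs0]; exact mem_extChartAt_target q)
  refine (ContDiffAt.comp (g := localRep L q) (y₀, v) h4 h3).congr_of_eventuallyEq ?_
  have h5 : ∀ᶠ y in 𝓝 y₀, s y ∈ projRepDomain E E' ρ q :=
    hs.continuousAt (by rwa [hs0])
  have h6 : Tendsto Prod.fst (𝓝 (y₀, v)) (𝓝 y₀) := continuousAt_fst
  filter_upwards [h6.eventually hsr, h6.eventually h5] with z hz1 hz2
  have := Γ.localRep_reducedLagrangian hsurj hinv q hz2 z.2
  rw [hz1] at this
  exact this

/-- The fibre derivatives of `L^*` and `L`. -/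
lemma fderiv_localRep_reducedLagrangian_fibre [CompleteSpace E']
    (hρ : ContMDiff 𝓘(ℝ, E) 𝓘(ℝ, E') ∞ ρ) (hsurj : Surjective ρ)
    (hL : ContMDiff 𝓘(ℝ, E).tangent 𝓘(ℝ, ℝ) ∞ L) (hinv : Γ.IsInvariant L) (q : Q) {x : E}
    (hx : x ∈ projRepDomain E E' ρ q) (v c : E') :
    fderiv ℝ (localRep (Γ.reducedLagrangian hsurj L) (ρ q)) (projRep E E' ρ q x, v) (0, c) =
      fderiv ℝ (localRep L q) (x, Γ.liftRep q x v) (0, Γ.liftRep q x c) := by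
  have h1 := ((contDiffAt_localRep (Γ.contMDiff_reducedLagrangian hρ hsurj hL hinv) (ρ q)
    (z := (projRep E E' ρ q x, v)) ((extChartAt 𝓘(ℝ, E') (ρ q)).map_source hx.2)).differentiableAt
      (by simp)).hasFDerivAt.comp v (hasFDerivAt_prodMk_right (𝕜 := ℝ) (projRep E E' ρ q x) v)
  have h2 := ((contDiffAt_localRep hL q (z := (x, Γ.liftRep q x v)) hx.1).differentiableAt
      (by simp)).hasFDerivAt.comp v ((hasFDerivAt_prodMk_right (𝕜 := ℝ) x
        (Γ.liftRep q x v)).comp v (Γ.liftRep q x).hasFDerivAt)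
  -- With `x` fixed, both sides of the defining relation of `L^*` are differentiated in the fibre
  -- variable, on which `ℓ(x)` acts linearly.
  have h3 := h1.unique (h2.congr_of_eventuallyEq
    (Eventually.of_forall fun v => Γ.localRep_reducedLagrangian hsurj hinv q hx v))
  simpa using congrArg (fun A : E' →L[ℝ] ℝ => A c) h3

/-- The derivatives of `L^*` and `L` along the base. -/
lemma fderiv_localRep_reducedLagrangian_base [CompleteSpace E']
    (hρ : ContMDiff 𝓘(ℝ, E) 𝓘(ℝ, E') ∞ ρ) (hsurj : Surjective ρ)
    (hL : ContMDiff 𝓘(ℝ, E).tangent 𝓘(ℝ, ℝ) ∞ L) (hinv : Γ.IsInvariant L) (q : Q) (v : E')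
    (a : E) :
    fderiv ℝ (localRep (Γ.reducedLagrangian hsurj L) (ρ q)) (extChartAt 𝓘(ℝ, E') (ρ q) (ρ q), v)
        (fderiv ℝ (projRep E E' ρ q) (extChartAt 𝓘(ℝ, E) q q) a, 0) =
      fderiv ℝ (localRep L q) (extChartAt 𝓘(ℝ, E) q q, Γ.liftModel q v)
        (a, Γ.liftRepDeriv q a v) := by
  have hdom := projRepDomain_mem_nhds hρ q
  set x₀ := extChartAt 𝓘(ℝ, E) q q with hx₀
  have hr := ((contDiffAt_projRep hρ q (mem_of_mem_nhds hdom)).differentiableAt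
    (by simp)).hasFDerivAt
  have h1 := HasFDerivAt.comp x₀ (f := fun x => (projRep E E' ρ q x, v))
    ((contDiffAt_localRep (Γ.contMDiff_reducedLagrangian hρ hsurj hL hinv) (ρ q)
    (z := (projRep E E' ρ q x₀, v)) ((extChartAt 𝓘(ℝ, E') (ρ q)).map_source
      (mem_of_mem_nhds hdom).2)).differentiableAt (by simp)).hasFDerivAt
      (hr.prodMk (hasFDerivAt_const v x₀))
  have h2 := HasFDerivAt.comp x₀ (f := fun x => (x, Γ.liftRep q x v))
    ((contDiffAt_localRep hL q (z := (x₀, Γ.liftRep q x₀ v))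
      (mem_of_mem_nhds hdom).1).differentiableAt (by simp)).hasFDerivAt
    ((hasFDerivAt_id x₀).prodMk ((Γ.hasFDerivAt_liftRep hρ q).clm_apply (hasFDerivAt_const v x₀)))
  have h3 := h1.unique (h2.congr_of_eventuallyEq
    (eventually_of_mem hdom fun x hx => Γ.localRep_reducedLagrangian hsurj hinv q hx v))
  have h4 := congrArg (fun A : E →L[ℝ] ℝ => A a) h3
  have h5 : projRep E E' ρ q x₀ = _ := projRep_self q
  have h6 : Γ.liftRep q x₀ = _ := Γ.liftRep_self q
  rw [h5, h6] at h4
  simpa using! h4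

/-- The second derivatives of `L^*` and `L`. -/
lemma localHess_reducedLagrangian [CompleteSpace E']
    (hρ : ContMDiff 𝓘(ℝ, E) 𝓘(ℝ, E') ∞ ρ) (hsurj : Surjective ρ)
    (hL : ContMDiff 𝓘(ℝ, E).tangent 𝓘(ℝ, ℝ) ∞ L) (hinv : Γ.IsInvariant L) (q : Q) (v c : E')
    (a : E) (b : E') :
    localHess (Γ.reducedLagrangian hsurj L) (ρ q) (extChartAt 𝓘(ℝ, E') (ρ q) (ρ q), v)
        (fderiv ℝ (projRep E E' ρ q) (extChartAt 𝓘(ℝ, E) q q) a, b) (0, c) =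
      localHess L q (extChartAt 𝓘(ℝ, E) q q, Γ.liftModel q v)
        (a, Γ.liftRepDeriv q a v + Γ.liftModel q b) (0, Γ.liftModel q c) +
      fderiv ℝ (localRep L q) (extChartAt 𝓘(ℝ, E) q q, Γ.liftModel q v)
        (0, Γ.liftRepDeriv q a c) := by
  have hdom := projRepDomain_mem_nhds hρ q
  set x₀ := extChartAt 𝓘(ℝ, E) q q with hx₀
  have hr := ((contDiffAt_projRep hρ q (mem_of_mem_nhds hdom)).differentiableAt
    (by simp)).hasFDerivAt
  have hfst : HasFDerivAt (fun z : E × E' => z.1) (ContinuousLinearMap.fst ℝ E E') (x₀, v) :=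
    hasFDerivAt_fst
  have hsnd : HasFDerivAt (fun z : E × E' => z.2) (ContinuousLinearMap.snd ℝ E E') (x₀, v) :=
    hasFDerivAt_snd
  have hℓ := HasFDerivAt.comp (x₀, v) (f := fun z : E × E' => z.1) (Γ.hasFDerivAt_liftRep hρ q) hfst
  have h1 := HasFDerivAt.comp (x₀, v) (f := fun z : E × E' => (projRep E E' ρ q z.1, z.2))
    (hasFDerivAt_fderiv_localRep (Γ.contMDiff_reducedLagrangian hρ hsurj hL hinv) (ρ q)
      (z := (projRep E E' ρ q x₀, v)) ((extChartAt 𝓘(ℝ, E') (ρ q)).map_source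
      (mem_of_mem_nhds hdom).2))
    ((HasFDerivAt.comp (x₀, v) (f := fun z : E × E' => z.1) hr hfst).prodMk hsnd)
  have h1' := h1.clm_apply (hasFDerivAt_const ((0, c) : E' × E') (x₀, v))
  have h2 := HasFDerivAt.comp (x₀, v) (f := fun z : E × E' => (z.1, Γ.liftRep q z.1 z.2))
    (hasFDerivAt_fderiv_localRep hL q (z := (x₀, Γ.liftRep q x₀ v)) (mem_of_mem_nhds hdom).1)
    (hfst.prodMk (hℓ.clm_apply hsnd))
  have h2' := h2.clm_apply ((hasFDerivAt_const (0 : E) (x₀, v)).prodMk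
    (hℓ.clm_apply (hasFDerivAt_const c (x₀, v))))
  -- The identity of fibre derivatives is differentiated once more, now jointly in `x` and `v`. The
  -- extra first-order term arises because the direction `ℓ(x) c` depends on `x`.
  have h3 := h1'.unique (h2'.congr_of_eventuallyEq (by
    have h5 : Tendsto Prod.fst (𝓝 (x₀, v)) (𝓝 x₀) := continuousAt_fst
    filter_upwards [h5 hdom] with z hz
    exact Γ.fderiv_localRep_reducedLagrangian_fibre hρ hsurj hL hinv q hz z.2 c))
  have h4 := congrArg (fun A : E × E' →L[ℝ] ℝ => A (a, b)) h3
  have h5 : projRep E E' ρ q x₀ = _ := projRep_self q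
  have h6 : Γ.liftRep q x₀ = _ := Γ.liftRep_self q
  simp only [comp_def, h5, h6] at h4
  simpa [add_comm, h6] using! h4

end EhresmannConnection

end Caplygin

/-! ### Correspondence of the dynamics and of the Hamilton–Jacobi conditions -/

section Caplygin

variable {E : Type*} [NormedAddCommGroup E] [NormedSpace ℝ E]
  {E' : Type*} [NormedAddCommGroup E'] [NormedSpace ℝ E']
  {Q : Type*} [TopologicalSpace Q] [ChartedSpace E Q] [IsManifold 𝓘(ℝ, E) ∞ Q]
  {N : Type*} [TopologicalSpace N] [ChartedSpace E' N] [IsManifold 𝓘(ℝ, E') ∞ N] {ρ : Q → N}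

/-- A nondegenerate bilinear form on a finite-dimensional space represents every functional. -/
lemma exists_eq_of_nondegenerate {F : Type*} [AddCommGroup F] [Module ℝ F] [FiniteDimensional ℝ F]
    (B : F →ₗ[ℝ] Module.Dual ℝ F) (hB : ∀ b, (∀ c, B b c = 0) → b = 0) (f : Module.Dual ℝ F) :
    ∃ b, B b = f := by
  have hinj : Injective B := (injective_iff_map_eq_zero B).2 fun b hb => hB b fun c => by simp [hb]
  exact (LinearMap.injective_iff_surjective_of_finrank_eq_finrank
    (Subspace.dual_finrank_eq).symm).1 hinj f

/-- The dynamics of a regular lagrangian with a semibasic force, in coordinates. -/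
lemma exists_forcedDynamics_eq [FiniteDimensional ℝ E'] {L : TangentBundle 𝓘(ℝ, E') N → ℝ}
    (hL : ContMDiff 𝓘(ℝ, E').tangent 𝓘(ℝ, ℝ) ∞ L) (y : N) (v : E')
    (hnd : ∀ b : E', (∀ c : E',
      localHess L y (extChartAt 𝓘(ℝ, E') y y, v) (0, b) (0, c) = 0) → b = 0)
    (α : (w : TangentBundle 𝓘(ℝ, E') N) → TangentSpace 𝓘(ℝ, E').tangent w → ℝ)
    (f : E' →ₗ[ℝ] ℝ) (hα : ∀ U : E' × E', α ⟨y, v⟩ U = f U.1) :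
    ∃ η : E', forcedDynamics L α ⟨y, v⟩ = (v, η) ∧
      ∀ c, localHess L y (extChartAt 𝓘(ℝ, E') y y, v) (v, η) (0, c) =
        fderiv ℝ (localRep L y) (extChartAt 𝓘(ℝ, E') y y, v) (c, 0) - f c := by
  set z : E' × E' := (extChartAt 𝓘(ℝ, E') y y, v)
  let B : E' →ₗ[ℝ] Module.Dual ℝ E' := LinearMap.mk₂ ℝ
    (fun b c => localHess L y z (0, b) (0, c))
    (fun b b' c => by rw [← add_apply, ← map_add, Prod.mk_add_mk, add_zero])
    (fun k b c => by rw [← smul_apply, ← map_smul, Prod.smul_mk, smul_zero])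
    (fun b c c' => by rw [← map_add, Prod.mk_add_mk, add_zero])
    (fun k b c => by rw [← map_smul, Prod.smul_mk, smul_zero])
  -- Finite dimension turns nondegeneracy of the vertical Hessian into solvability for the
  -- acceleration. A solution must be exhibited before `Classical.epsilon` carries any information.
  obtain ⟨η, hη⟩ := exists_eq_of_nondegenerate B hnd
    (((fderiv ℝ (localRep L y) z).comp (ContinuousLinearMap.inl ℝ E' E') -
      (localHess L y z (v, 0)).comp (ContinuousLinearMap.inr ℝ E' E') : E' →L[ℝ] ℝ).toLinearMap - f)
  have hη' : ∀ c, localHess L y z (0, η) (0, c) =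
      fderiv ℝ (localRep L y) z (c, 0) - localHess L y z (v, 0) (0, c) - f c := fun c =>
    congrArg (fun A : Module.Dual ℝ E' => A c) hη
  have hsplit : ∀ b c, localHess L y z (v, b) (0, c) =
      localHess L y z (v, 0) (0, c) + localHess L y z (0, b) (0, c) := fun b c => by
    rw [← add_apply, ← map_add, Prod.mk_add_mk, add_zero, zero_add]
  have heq : ∀ c, localHess L y z (v, η) (0, c) =
      fderiv ℝ (localRep L y) z (c, 0) - f c := fun c => by
    rw [hsplit, hη']; ring
  refine ⟨η, ?_, heq⟩
  have hiff := forced_equation_iff hL y v hnd f (map_zero f)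
  have hspec : ∀ U : E' × E', cartanTwoForm L ⟨y, v⟩ (forcedDynamics L α ⟨y, v⟩) U =
      tdiff (energy L) ⟨y, v⟩ U + f U.1 := fun U => by
    rw [← hα]
    exact Classical.epsilon_spec (p := fun Z => ∀ U, cartanTwoForm L ⟨y, v⟩ Z U =
      tdiff (energy L) ⟨y, v⟩ U + α ⟨y, v⟩ U)
      ⟨(v, η), fun U => ((hiff (v, η)).2 ⟨rfl, heq⟩ U).trans
        (congrArg (tdiff (energy L) ⟨y, v⟩ U + ·) (hα U).symm)⟩ U
  have key : ∀ Z : E' × E', (∀ U : E' × E', cartanTwoForm L ⟨y, v⟩ Z U =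
      tdiff (energy L) ⟨y, v⟩ U + f U.1) → Z = (v, η) := by
    rintro ⟨v', b⟩ hZ
    obtain ⟨rfl, h2⟩ := (hiff _).1 hZ
    have h3 : b - η = 0 := hnd _ fun c => by
      have h4 : ((0, b - η) : E' × E') = (0, b) - (0, η) := by simp
      have h5 := h2 c
      have h6 := heq c
      rw [hsplit] at h5 h6
      rw [h4, map_sub, sub_apply]
      linarith
    rw [sub_eq_zero.1 h3]
  exact key _ hspec

namespace EhresmannConnection

variable (Γ : EhresmannConnection E E' ρ) {L : TangentBundle 𝓘(ℝ, E) Q → ℝ}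

/-- The nonholonomic dynamics and the reduced forced dynamics correspond to each other. -/
lemma exists_dynamics_eq [FiniteDimensional ℝ E'] (hρ : ContMDiff 𝓘(ℝ, E) 𝓘(ℝ, E') ∞ ρ)
    (hsurj : Surjective ρ) (hL : ContMDiff 𝓘(ℝ, E).tangent 𝓘(ℝ, ℝ) ∞ L)
    (hcompat : IsCompatible L Γ.hor) (hinv : Γ.IsInvariant L) (hforce : Γ.ForceWellDefined L)
    (q : Q) (v : E') :
    ∃ η : E', forcedDynamics (Γ.reducedLagrangian hsurj L) (Γ.reducedForce hsurj L) ⟨ρ q, v⟩ =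
        (v, η) ∧
      nonholonomicDynamics L Γ.hor ⟨q, Γ.liftModel q v⟩ =
        (Γ.liftModel q v, Γ.liftRepDeriv q (Γ.liftModel q v) v + Γ.liftModel q η) := by
  have : CompleteSpace E' := FiniteDimensional.complete ℝ E'
  obtain ⟨K', hK, hK'⟩ := Γ.exists_hasFDerivAt_horRep hρ q
  have hproj : ∀ᶠ x in 𝓝 (extChartAt 𝓘(ℝ, E) q q), ∀ v : E,
      projMap Γ.hor (chartPoint q (x, v)) = chartPoint q (x, Γ.horRep q x v) :=
    eventually_of_mem (projRepDomain_mem_nhds hρ q) fun x hx => Γ.projMap_hor_chartPoint hρ q hx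
  have hv := Γ.horRep_self_liftModel hρ q v
  have hw := Γ.liftModel_mem_constraintSet q v
  have hr := Γ.fderiv_projRep_liftModel hρ q
  have hhess := Γ.localHess_reducedLagrangian hρ hsurj hL hinv q v
  have hbase := Γ.fderiv_localRep_reducedLagrangian_base hρ hsurj hL hinv q v
  have hKself : ∀ a, Γ.horRep q (extChartAt 𝓘(ℝ, E) q q) a =
      Γ.liftModel q (fderiv ℝ (projRep E E' ρ q) (extChartAt 𝓘(ℝ, E) q q) a) := fun a => by
    rw [horRep, Γ.liftRep_self]; rfl
  set x₀ := extChartAt 𝓘(ℝ, E) q q with hx₀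
  set p := fderiv ℝ (localRep L q) (x₀, Γ.liftModel q v) with hp
  -- The vertical Hessian of `L^*` at `v` is that of `L` at `ℓ v` restricted to horizontal vectors,
  -- where compatibility gives nondegeneracy.
  have hnd : ∀ b : E', (∀ c : E', localHess (Γ.reducedLagrangian hsurj L) (ρ q)
      (extChartAt 𝓘(ℝ, E') (ρ q) (ρ q), v) (0, b) (0, c) = 0) → b = 0 := by
    intro b hb
    have h1 := eq_zero_of_localHess_eq_zero hL hcompat hK hproj hv hw (Γ.liftModel q b) (fun c => by
      rw [hKself, hKself, hr]
      have h2 := hhess (fderiv ℝ (projRep E E' ρ q) x₀ c) 0 b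
      simp only [map_zero, zero_apply, zero_add, hb, Prod.mk_zero_zero, add_zero] at h2
      exact h2.symm)
    rw [hKself, hr] at h1
    have h2 := hr b
    rw [h1, map_zero] at h2
    exact h2.symm
  let f : E' →ₗ[ℝ] ℝ :=
    { toFun := fun c => -p (0, Γ.liftRepDeriv q (Γ.liftModel q v) c -
        Γ.liftRepDeriv q (Γ.liftModel q c) v)
      map_add' := fun c c' => by
        rw [← neg_add, ← map_add, Prod.mk_add_mk, add_zero]
        simp only [map_add, add_apply]
        congr 3
        abel
      map_smul' := fun k c => by
        rw [RingHom.id_apply, smul_neg, ← map_smul, Prod.smul_mk, smul_zero]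
        simp only [map_smul, smul_apply, smul_sub] }
  have hα : ∀ U : E' × E', Γ.reducedForce hsurj L ⟨ρ q, v⟩ U = f U.1 := fun U => by
    rw [Γ.reducedForce_eq hsurj hforce, Γ.curvature_liftModel hρ]
    have hd : DifferentiableAt ℝ (localRep L q) (extChartAt 𝓘(ℝ, E) q q, Γ.liftModel q v) :=
      (contDiffAt_localRep hL q (mem_extChartAt_target q)).differentiableAt (by simp)
    rw [legendre_eq_fderiv_localRep hd]
    rfl
  obtain ⟨η, hη, heq⟩ := exists_forcedDynamics_eq
    (Γ.contMDiff_reducedLagrangian hρ hsurj hL hinv) (ρ q) v hnd _ f hα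
  refine ⟨η, hη, ?_⟩
  -- The second-order vectors tangent to `ℋ` are parametrised by `b` through `K' (ℓ v) (ℓ v) + K b`.
  -- Subtracting `D²r(ℓ v, ℓ v)` in `b` offsets the term with `D²r` in `K'`.
  have hb : K' (Γ.liftModel q v) (Γ.liftModel q v) + Γ.horRep q x₀ (Γ.liftModel q
      (η - fderiv ℝ (fderiv ℝ (projRep E E' ρ q)) x₀ (Γ.liftModel q v) (Γ.liftModel q v))) =
      Γ.liftRepDeriv q (Γ.liftModel q v) v + Γ.liftModel q η := by
    rw [hK', hKself, hr, map_sub]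
    abel
  rw [← hb]
  refine nonholonomicDynamics_eq_of_coordinates hL hcompat hK hproj hv hw _ fun a => ?_
  rw [hb, hKself]
  set c := fderiv ℝ (projRep E E' ρ q) x₀ a
  have h1 := hhess c (Γ.liftModel q v) η
  have h2 := hbase (Γ.liftModel q c)
  have h3 := heq c
  have h4 : f c = -p (0, Γ.liftRepDeriv q (Γ.liftModel q v) c -
        Γ.liftRepDeriv q (Γ.liftModel q c) v) := rfl
  rw [hr] at h1 h2
  have h5 : p (Γ.liftModel q c, Γ.liftRepDeriv q (Γ.liftModel q c) v) =
      p (Γ.liftModel q c, 0) + p (0, Γ.liftRepDeriv q (Γ.liftModel q c) v) := by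
    rw [← map_add, Prod.mk_add_mk, add_zero, zero_add]
  have h6 : p (0, Γ.liftRepDeriv q (Γ.liftModel q v) c -
        Γ.liftRepDeriv q (Γ.liftModel q c) v) = p (0, Γ.liftRepDeriv q (Γ.liftModel q v) c) -
        p (0, Γ.liftRepDeriv q (Γ.liftModel q c) v) := by
    rw [← map_sub, Prod.mk_sub_mk, sub_zero]
  -- The force contributes `p(0, Dℓ(ℓ v) c) - p(0, Dℓ(ℓ c) v)`, which cancels the extra term of the
  -- Hessian of `L^*` and that of its base derivative.
  linarith

end EhresmannConnection

/-- A vector field in the chart at `q`. -/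
noncomputable def fieldRep (X : (q : Q) → TangentSpace 𝓘(ℝ, E) q) (q : Q) (x : E) : E :=
  chartCoframe q ((extChartAt 𝓘(ℝ, E) q).symm x) (X ((extChartAt 𝓘(ℝ, E) q).symm x))

lemma differentiableAt_fieldRep {X : (q : Q) → TangentSpace 𝓘(ℝ, E) q} (hX : IsSmoothField X)
    (q : Q) : DifferentiableAt ℝ (fieldRep X q) (extChartAt 𝓘(ℝ, E) q q) := by
  have h1 : ContMDiffAt 𝓘(ℝ, E) 𝓘(ℝ, E) ∞ (extChartAt 𝓘(ℝ, E) q).symm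
      (extChartAt 𝓘(ℝ, E) q q) :=
    (contMDiffOn_extChartAt_symm q).contMDiffAt (extChartAt_target_mem_nhds q)
  have h2 : ContMDiffAt 𝓘(ℝ, E) 𝓘(ℝ, E).tangent ∞ (fun x => (⟨(extChartAt 𝓘(ℝ, E) q).symm x,
      X ((extChartAt 𝓘(ℝ, E) q).symm x)⟩ : TangentBundle 𝓘(ℝ, E) Q))
      (extChartAt 𝓘(ℝ, E) q q) :=
    ContMDiffAt.comp (extChartAt 𝓘(ℝ, E) q q) (g := fun q => (⟨q, X q⟩ : TangentBundle 𝓘(ℝ, E) Q))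
      hX.contMDiffAt h1
  have h3 : ContMDiffAt 𝓘(ℝ, E).tangent 𝓘(ℝ, E × E) ∞
      (extChartAt 𝓘(ℝ, E).tangent (⟨q, 0⟩ : TangentBundle 𝓘(ℝ, E) Q))
      ⟨(extChartAt 𝓘(ℝ, E) q).symm (extChartAt 𝓘(ℝ, E) q q),
        X ((extChartAt 𝓘(ℝ, E) q).symm (extChartAt 𝓘(ℝ, E) q q))⟩ :=
    contMDiffAt_extChartAt' (by
      rw [TangentBundle.mem_chart_source_iff, extChartAt_to_inv]
      exact mem_chart_source E q)
  have h4 := (ContMDiffAt.comp (extChartAt 𝓘(ℝ, E) q q)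
    (f := fun x => (⟨(extChartAt 𝓘(ℝ, E) q).symm x,
      X ((extChartAt 𝓘(ℝ, E) q).symm x)⟩ : TangentBundle 𝓘(ℝ, E) Q)) h3 h2).contDiffAt.differentiableAt (by simp)
  refine (differentiableAt_snd.comp _ h4).congr_of_eventuallyEq ?_
  filter_upwards [extChartAt_target_mem_nhds (I := 𝓘(ℝ, E)) q] with x hx
  exact (congrArg Prod.snd (extChartAt_tangent_apply (⟨q, 0⟩ : TangentBundle 𝓘(ℝ, E) Q)
    ⟨(extChartAt 𝓘(ℝ, E) q).symm x, X ((extChartAt 𝓘(ℝ, E) q).symm x)⟩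
    ((extChartAt 𝓘(ℝ, E) q).map_target hx))).symm

lemma fieldRep_self (X : (q : Q) → TangentSpace 𝓘(ℝ, E) q) (q : Q) :
    fieldRep X q (extChartAt 𝓘(ℝ, E) q q) = X q := by
  rw [fieldRep, extChartAt_to_inv, chartCoframe_self]; rfl

/-- The tangent map of a vector field in coordinates. -/
lemma mfderiv_field {X : (q : Q) → TangentSpace 𝓘(ℝ, E) q} (q : Q) {A : E →L[ℝ] E}
    (hX : HasFDerivAt (fieldRep X q) A (extChartAt 𝓘(ℝ, E) q q)) (a : E) :
    mfderiv 𝓘(ℝ, E) 𝓘(ℝ, E).tangent (fun q => (⟨q, X q⟩ : TangentBundle 𝓘(ℝ, E) Q)) q a =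
      (a, A a) := by
  have h1 : HasMFDerivAt 𝓘(ℝ, E) 𝓘(ℝ, E × E) (fun x => (x, fieldRep X q x))
      (extChartAt 𝓘(ℝ, E) q q) ((ContinuousLinearMap.id ℝ E).prod A) :=
    ((hasFDerivAt_id _).prodMk hX).hasMFDerivAt
  have h2 : HasMFDerivAt 𝓘(ℝ, E × E) 𝓘(ℝ, E).tangent (chartPoint q)
      (extChartAt 𝓘(ℝ, E) q q, fieldRep X q (extChartAt 𝓘(ℝ, E) q q))
      (ContinuousLinearMap.id ℝ (E × E)) := by
    rw [← chartPointDeriv_self q (fieldRep X q (extChartAt 𝓘(ℝ, E) q q))]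
    exact hasMFDerivAt_chartPoint q (mem_extChartAt_target q)
  have h3 : HasMFDerivAt 𝓘(ℝ, E) 𝓘(ℝ, E) (extChartAt 𝓘(ℝ, E) q) q
      (ContinuousLinearMap.id ℝ E) := by
    rw [← chartCoframe_self q]
    exact hasMFDerivAt_chart q (mem_extChartAt_source q)
  have h4 : HasMFDerivAt 𝓘(ℝ, E) 𝓘(ℝ, E).tangent
      (fun q => (⟨q, X q⟩ : TangentBundle 𝓘(ℝ, E) Q)) q ((ContinuousLinearMap.id ℝ E).prod A) := by
    refine (HasMFDerivAt.comp q (HasMFDerivAt.comp _ h2 h1) h3).congr_of_eventuallyEq ?_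
    filter_upwards [extChartAt_source_mem_nhds (I := 𝓘(ℝ, E)) q] with q' hq'
    have h5 := (extChartAt 𝓘(ℝ, E) q).left_inv hq'
    have h6 : ∀ q'' (h : q'' = q'), (⟨q', X q'⟩ : TangentBundle 𝓘(ℝ, E) Q) =
        ⟨q'', chartFrame q (extChartAt 𝓘(ℝ, E) q q') (chartCoframe q q'' (X q''))⟩ := by
      intro q'' h
      subst h
      exact congrArg (fun u : E => (⟨q'', u⟩ : TangentBundle 𝓘(ℝ, E) Q))
        (chartFrame_chartCoframe q hq' _).symm
    exact h6 _ h5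
  rw [h4.mfderiv]
  rfl

namespace EhresmannConnection

variable (Γ : EhresmannConnection E E' ρ)

lemma fieldRep_liftField (Y : (y : N) → TangentSpace 𝓘(ℝ, E') y) (q : Q) {x : E}
    (hx : x ∈ projRepDomain E E' ρ q) :
    fieldRep (Γ.liftField Y) q x = Γ.liftRep q x (fieldRep Y (ρ q) (projRep E E' ρ q x)) := by
  have h1 : chartFrame (ρ q) (projRep E E' ρ q x) (fieldRep Y (ρ q) (projRep E E' ρ q x)) =
      Y (ρ ((extChartAt 𝓘(ℝ, E) q).symm x)) := by
    rw [fieldRep, projRep, (extChartAt 𝓘(ℝ, E') (ρ q)).left_inv hx.2]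
    exact chartFrame_chartCoframe (ρ q) hx.2 _
  rw [liftRep, ContinuousLinearMap.comp_apply, ContinuousLinearMap.comp_apply, h1]
  rfl

/-- The product rule for `x ↦ ℓ(x) (Y (r x))`. Along `a = ℓ Y` its first term is the same `Dℓ(ℓ Y)
Y` that appears in the nonholonomic dynamics. -/
lemma hasFDerivAt_fieldRep_liftField (hρ : ContMDiff 𝓘(ℝ, E) 𝓘(ℝ, E') ∞ ρ)
    {Y : (y : N) → TangentSpace 𝓘(ℝ, E') y} (hY : IsSmoothField Y) (q : Q) :
    ∃ A : E →L[ℝ] E, HasFDerivAt (fieldRep (Γ.liftField Y) q) A (extChartAt 𝓘(ℝ, E) q q) ∧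
      ∀ a, A a = Γ.liftRepDeriv q a (Y (ρ q)) + Γ.liftModel q
        (fderiv ℝ (fieldRep Y (ρ q)) (extChartAt 𝓘(ℝ, E') (ρ q) (ρ q))
          (fderiv ℝ (projRep E E' ρ q) (extChartAt 𝓘(ℝ, E) q q) a)) := by
  have hdom := projRepDomain_mem_nhds hρ q
  have hr := ((contDiffAt_projRep hρ q (mem_of_mem_nhds hdom)).differentiableAt
    (by simp)).hasFDerivAt
  have hy : HasFDerivAt (fieldRep Y (ρ q))
      (fderiv ℝ (fieldRep Y (ρ q)) (extChartAt 𝓘(ℝ, E') (ρ q) (ρ q)))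
      (projRep E E' ρ q (extChartAt 𝓘(ℝ, E) q q)) := by
    rw [projRep_self]; exact (differentiableAt_fieldRep hY (ρ q)).hasFDerivAt
  refine ⟨_, ((Γ.hasFDerivAt_liftRep hρ q).clm_apply (hy.comp _ hr)).congr_of_eventuallyEq
    (eventually_of_mem hdom fun x hx => Γ.fieldRep_liftField Y q hx), fun a => ?_⟩
  have h1 : fieldRep Y (ρ q) (projRep E E' ρ q (extChartAt 𝓘(ℝ, E) q q)) = Y (ρ q) := by
    rw [projRep_self, fieldRep_self]
  simp only [comp_apply, add_apply, ContinuousLinearMap.comp_apply, Γ.liftRep_self, h1]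
  exact add_comm _ _

lemma isSmoothField_liftField (hρ : ContMDiff 𝓘(ℝ, E) 𝓘(ℝ, E') ∞ ρ)
    {Y : (y : N) → TangentSpace 𝓘(ℝ, E') y} (hY : IsSmoothField Y) :
    IsSmoothField (Γ.liftField Y) := fun q =>
  ContMDiffAt.clm_apply_of_inCoordinates (b₁ := ρ) (b₂ := id) (v := fun q => Y (ρ q))
    (ϕ := Γ.lift) (Γ.smooth q)
    (ContMDiffAt.comp q (g := fun y => (⟨y, Y y⟩ : TangentBundle 𝓘(ℝ, E') N)) hY.contMDiffAt
      hρ.contMDiffAt) contMDiffAt_id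

/-- The Hamilton–Jacobi conditions on curves for `Y` and its horizontal lift are equivalent. -/
lemma hjCurveCondition_liftField_iff [FiniteDimensional ℝ E] [FiniteDimensional ℝ E']
    {L : TangentBundle 𝓘(ℝ, E) Q → ℝ} (hρ : ContMDiff 𝓘(ℝ, E) 𝓘(ℝ, E') ∞ ρ)
    (hsurj : Surjective ρ) (hL : ContMDiff 𝓘(ℝ, E).tangent 𝓘(ℝ, ℝ) ∞ L)
    (hcompat : IsCompatible L Γ.hor) (hinv : Γ.IsInvariant L) (hforce : Γ.ForceWellDefined L)
    {Y : (y : N) → TangentSpace 𝓘(ℝ, E') y} (hY : IsSmoothField Y) :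
    HJCurveCondition (nonholonomicDynamics L Γ.hor) (Γ.liftField Y) ↔
      HJCurveCondition (forcedDynamics (Γ.reducedLagrangian hsurj L) (Γ.reducedForce hsurj L)) Y := by
  have : CompleteSpace E := FiniteDimensional.complete ℝ E
  have : CompleteSpace E' := FiniteDimensional.complete ℝ E'
  have hdyn := fun q => Γ.exists_dynamics_eq hρ hsurj hL hcompat hinv hforce q (Y (ρ q))
  -- Surjectivity of `ρ` lets the condition on `N` be indexed by points of `Q`, so the two
  -- conditions can be compared point by point.
  rw [hjCurveCondition_iff (Γ.isSmoothField_liftField hρ hY),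
    hjCurveCondition_iff hY, hsurj.forall]
  · refine forall_congr' fun q => ?_
    obtain ⟨η, h1, h2⟩ := hdyn q
    obtain ⟨A, hA, hA'⟩ := Γ.hasFDerivAt_fieldRep_liftField hρ hY q
    have h4 := mfderiv_field (ρ q) (differentiableAt_fieldRep hY (ρ q)).hasFDerivAt (Y (ρ q))
    have hr := Γ.fderiv_projRep_liftModel hρ q
    have hA'' : ∀ c : E', A (Γ.liftModel q c) =
        Γ.liftRepDeriv q (Γ.liftModel q c) (Y (ρ q)) + Γ.liftModel q
          (fderiv ℝ (fieldRep Y (ρ q)) (extChartAt 𝓘(ℝ, E') (ρ q) (ρ q)) c) := fun c => by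
      rw [hA', hr]
    have h3 := (mfderiv_field q hA (Γ.liftModel q (Y (ρ q)))).trans
      (congrArg (Prod.mk (Γ.liftModel q (Y (ρ q)))) (hA'' (Y (ρ q))))
    have key : ∀ (y e : E') (u w : E) (a b : E × E) (c d : E' × E'),
        a = (u, w + Γ.liftModel q e) → b = (u, w + Γ.liftModel q η) → c = (y, e) → d = (y, η) →
        (a = b ↔ c = d) := by
      rintro y e u w _ _ _ _ rfl rfl rfl rfl
      rw [Prod.mk.injEq, Prod.mk.injEq, add_right_inj]
      refine ⟨fun h => ⟨rfl, ?_⟩, fun h => ⟨rfl, by rw [h.2]⟩⟩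
      -- Applying `Dr` undoes `ℓ`, so the horizontal parts determine the accelerations on `N`.
      have h5 := congrArg (fderiv ℝ (projRep E E' ρ q) (extChartAt 𝓘(ℝ, E) q q)) h.2
      rwa [hr, hr] at h5
    exact key _ _ _ _ _ _ _ _ h3 h2 h4 h1
  · refine hsurj.forall.2 fun q => ?_
    obtain ⟨η, h1, h2⟩ := hdyn q
    exact (congrArg (fun Z : E' × E' => tauDeriv (⟨ρ q, Y (ρ q)⟩ : TangentBundle 𝓘(ℝ, E') N) Z)
      h1).trans (tauDeriv_mk (ρ q) _ _)
  · intro q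
    obtain ⟨η, h1, h2⟩ := hdyn q
    exact (congrArg (fun Z : E × E => tauDeriv (⟨q, Γ.liftModel q (Y (ρ q))⟩ :
      TangentBundle 𝓘(ℝ, E) Q) Z) h2).trans (tauDeriv_mk q _ _)

end EhresmannConnection

end Caplygin

theorem mainTheorem5
    {E : Type*} [NormedAddCommGroup E] [NormedSpace ℝ E] [FiniteDimensional ℝ E]
    {E' : Type*} [NormedAddCommGroup E'] [NormedSpace ℝ E'] [FiniteDimensional ℝ E']
    {Q : Type*} [TopologicalSpace Q] [T2Space Q] [SecondCountableTopology Q]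
    [ChartedSpace E Q] [IsManifold 𝓘(ℝ, E) ∞ Q]
    {N : Type*} [TopologicalSpace N] [T2Space N] [SecondCountableTopology N]
    [ChartedSpace E' N] [IsManifold 𝓘(ℝ, E') ∞ N]
    (ρ : Q → N) (hρ : IsFibredManifold (E := E) (E' := E') ρ)
    (Γ : EhresmannConnection E E' ρ)
    (L : TangentBundle 𝓘(ℝ, E) Q → ℝ) (hL : ContMDiff 𝓘(ℝ, E).tangent 𝓘(ℝ, ℝ) ∞ L)
    (hreg : IsHyperregular L) (hcompat : IsCompatible L Γ.hor)
    (hinv : Γ.IsInvariant L) (hforce : Γ.ForceWellDefined L) :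
    (∀ (X : (q : Q) → TangentSpace 𝓘(ℝ, E) q) (Y : (y : N) → TangentSpace 𝓘(ℝ, E') y),
      IsSmoothField Y →
      IsNonholonomicHJSolution L Γ.hor X →
      (∀ q, mfderiv 𝓘(ℝ, E) 𝓘(ℝ, E') ρ q (X q) = Y (ρ q)) →
      IsClosedForm 𝓘(ℝ, E') (legendreField (Γ.reducedLagrangian hρ.surjective L) Y) →
      IsForcedHJSolution (Γ.reducedLagrangian hρ.surjective L)
        (Γ.reducedForce hρ.surjective L) Y) ∧
    (∀ Y : (y : N) → TangentSpace 𝓘(ℝ, E') y,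
      IsForcedHJSolution (Γ.reducedLagrangian hρ.surjective L)
        (Γ.reducedForce hρ.surjective L) Y →
      InIdealOfAnnihilator 𝓘(ℝ, E) (fun q => LinearMap.range (Γ.hor q).toLinearMap)
        (formDeriv 𝓘(ℝ, E) (legendreField L (Γ.liftField Y))) →
      IsNonholonomicHJSolution L Γ.hor (Γ.liftField Y)) := by
  have hiff := fun {Y : (y : N) → TangentSpace 𝓘(ℝ, E') y} (hY : IsSmoothField Y) =>
    Γ.hjCurveCondition_liftField_iff hρ.smooth hρ.surjective hL hcompat hinv hforce hY
  refine ⟨fun X Y hY hX hproj hclosed => ⟨hY, hclosed, ?_⟩, fun Y hY hideal =>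
    ⟨Γ.isSmoothField_liftField hρ.smooth hY.smooth,
      fun q => Γ.liftModel_mem_constraintSet q (Y (ρ q)), hideal, (hiff hY.smooth).2 hY.curves⟩⟩
  -- A horizontal vector is the lift of its own projection, so horizontality and projectability
  -- together determine `X`.
  have hXY : X = Γ.liftField Y := funext fun q => by
    obtain ⟨u, hu⟩ := hX.mem q
    change Γ.lift q (mfderiv 𝓘(ℝ, E) 𝓘(ℝ, E') ρ q u) = X q at hu
    have h1 := hproj q
    rw [← hu, Γ.mfderiv_lift] at h1
    rw [← hu, h1]
    rfl
  exact (hiff hY).1 (hXY ▸ hX.curves)
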